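/- Let $G=SL_2(\mathbf R)$, $K=SO(2)$, $\mathfrak g=\mathfrak{sl}_2(\mathbf R)$, $\mathfrak k=\mathrm{Lie}(K)$, and let $k\neq 1$ be an integer. Let $\Gamma\subset SL_2(\mathbf Z)$ be a subgroup of finite index and $\chi$ a one-dimensional complex representation of $\Gamma$. A scalar-valued weak harmonic Maaß form of weight $k$ and type $\chi$ is a smooth function $F:\mathbf H\to\mathbf C$ with $F(\gamma\tau)=(c\tau+d)^k\chi(\gamma)F(\tau)$ for all $\gamma=\begin{pmatrix}a&b\\c&d\end{pmatrix}\in\Gamma$, with growth $O(e^{Bv})$ for some $B>0$ as $v\to\infty$, uniformly in $u$ ($\tau=u+iv$), at all cusps, and with $\Delta_kF=0$, where $\Delta_k=-v^2(\partial_u^2+\partial_v^2)+ikv(\partial_u+i\partial_v)$. Suppose that $F$ has a Fourier expansion $F=F^++F^-$, for some integer width $h\ge 1$ and $q=e^{2\pi i\tau}$, $$F^+(\tau)=\sum_{n\gg-\infty}c^+(n)q^{n/h},\qquad F^-(\tau)=c^-(0)v^{1-k}+\sum_{n\ll\infty,\ n\ne0}c^-(n)W_k(2\pi nv/h)\,q^{n/h},$$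 where $W_k(x)=\mathrm{Re}\,\Gamma(1-k,-2x)$. The holomorphic part $F^+$ is called a mock modular form of weight $k$. Its lift to $G$ is the function $g\mapsto (ci+d)^{-k}F^+(gi)$, $g=\begin{pmatrix}a&b\\c&d\end{pmatrix}$, and $V_{F^+}$ denotes the $(\mathfrak g,K)$-module generated by this lift inside the space of smooth right $K$-finite functions on $G$, with $\mathfrak g$ acting by left invariant vector fields and $K$ by right translation. For a $(\mathfrak g,K)$-module $V$, let $H^i(\mathfrak g,K;V)$ be the cohomology of the complex $\mathrm{Hom}_K(\wedge^i(\mathfrak g/\mathfrak k),V)$ with the Chevalley–Eilenberg differential. $V$ is called cohomological if $H^i(\mathfrak g,K;V\otimes M)\neq0$ for some $i$ and some finite-dimensional $(\mathfrak g,K)$-module $M$. **Theorem.** Let $F^+$ be a nonzero mock modular form of weight $k\in\mathbf Z\setminus\{1\}$. Then $V_{F^+}$ is cohomological, that is, $H^i(\mathfrak g,K;V_{F^+}\otimes M)\neq 0$ for some $i$ and some finite-dimensional $(\mathfrak g,K)$-module $M$. Moreover, if $k\in\{0,2\}$, then one can take trivial coefficients: $H^i(\mathfrak g,K;V_{F^+})\neq0$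 for some $i$. -/

import Mathlib

open scoped ContDiff MatrixGroups UpperHalfPlane TensorProduct

namespace MockModular

/-! ### The group `G = SL(2, ℝ)`, its Lie algebra `𝔤` and the maximal compact subgroup `K = SO(2)` -/

/-- The real Lie algebra `𝔤 = 𝔰𝔩(2, ℝ)` of traceless real `2 × 2` matrices. -/
abbrev LieG : Type := LieAlgebra.SpecialLinear.sl (Fin 2) ℝ

/-- The maximal compact subgroup `K = SO(2)` of `SL(2, ℝ)`. -/
def SO2 : Subgroup SL(2, ℝ) where
  carrier := {g | g.1 * g.1.transpose = 1}
  one_mem' := by simp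
  mul_mem' := by
    intro a b ha hb
    simp only [Set.mem_ofPred_eq, Matrix.SpecialLinearGroup.coe_mul, Matrix.transpose_mul] at *
    calc a.1 * b.1 * (b.1.transpose * a.1.transpose)
        = a.1 * (b.1 * b.1.transpose) * a.1.transpose := by simp only [Matrix.mul_assoc]
      _ = 1 := by rw [hb, Matrix.mul_one, ha]
  inv_mem' := by
    intro a ha
    have h1 : a⁻¹.1 * a.1 = 1 := by
      rw [← Matrix.SpecialLinearGroup.coe_mul, inv_mul_cancel, Matrix.SpecialLinearGroup.coe_one]
    have h2 : a⁻¹.1 = a.1.transpose := by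
      calc a⁻¹.1 = a⁻¹.1 * (a.1 * a.1.transpose) := by rw [show a.1 * a.1.transpose = 1 from ha,
            Matrix.mul_one]
        _ = a.1.transpose := by rw [← Matrix.mul_assoc, h1, Matrix.one_mul]
    change a⁻¹.1 * a⁻¹.1.transpose = 1
    rw [h2, Matrix.transpose_transpose, ← h2, h1]

/-- The rotation `k_θ = (cos θ, sin θ; - sin θ, cos θ)` in `K`. -/
noncomputable def rot (θ : ℝ) : SO2 :=
  ⟨⟨!![Real.cos θ, Real.sin θ; -Real.sin θ, Real.cos θ], by
    rw [Matrix.det_fin_two_of]; nlinarith [Real.sin_sq_add_cos_sq θ]⟩, by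
    change _ * _ = (1 : Matrix (Fin 2) (Fin 2) ℝ)
    ext i j
    fin_cases i <;> fin_cases j <;> simp [Matrix.mul_apply, Fin.sum_univ_two] <;>
      nlinarith [Real.sin_sq_add_cos_sq θ]⟩

/-- The Lie algebra `𝔨` of `K`, i.e. the skew-symmetric matrices in `𝔤`. -/
def lieK : Submodule ℝ LieG where
  carrier := {X | X.1.transpose = -X.1}
  zero_mem' := by simp
  add_mem' := by
    intro a b ha hb
    simp only [Set.mem_ofPred_eq] at *
    simp [ha, hb, add_comm]
  smul_mem' := by
    intro c a ha
    simp only [Set.mem_ofPred_eq] at *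
    simp [ha]

/-- The generator `d/dθ k_θ` at `θ = 0` of `𝔨`. -/
def rotGen : LieG :=
  ⟨!![0, 1; -1, 0], by
    change Matrix.trace (_ : Matrix (Fin 2) (Fin 2) ℝ) = 0
    simp [Matrix.trace_fin_two]⟩

/-- The adjoint action `X ↦ g X g⁻¹` of `G` on `𝔤`. -/
def Ad (g : SL(2, ℝ)) : LieG →ₗ[ℝ] LieG where
  toFun X := ⟨g.1 * X.1 * g⁻¹.1, by
    change Matrix.trace (_ : Matrix (Fin 2) (Fin 2) ℝ) = 0
    have h : Matrix.trace X.1 = 0 := X.2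
    rw [Matrix.trace_mul_comm, ← Matrix.mul_assoc, ← Matrix.SpecialLinearGroup.coe_mul,
      inv_mul_cancel, Matrix.SpecialLinearGroup.coe_one, Matrix.one_mul, h]⟩
  map_add' X Y := by ext1; simp [Matrix.mul_add, Matrix.add_mul]
  map_smul' c X := by ext1; simp

/-! ### `(𝔤, K)`-modules -/

/-- A `(𝔤, K)`-module structure on a complex vector space `V`: a representation of the real Lie
algebra `𝔤` and a locally finite, continuous representation of `K`, such that the two actions are
compatible with the adjoint action of `K` and the derivative of the action of `K` is the
restriction of the action of `𝔤` to `𝔨 = ℝ · rotGen`.  (On the finite-dimensional `K`-stable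
subspaces, differentiability is tested against linear functionals.) -/
structure GKModule (V : Type*) [AddCommGroup V] [Module ℂ V] where
  lie : LieG →ₗ[ℝ] Module.End ℂ V
  grp : SO2 →* Module.End ℂ V
  lie_bracket : ∀ (X Y : LieG) (v : V), lie ⁅X, Y⁆ v = lie X (lie Y v) - lie Y (lie X v)
  grp_lie : ∀ (κ : SO2) (X : LieG) (v : V), grp κ (lie X v) = lie (Ad κ X) (grp κ v)
  grp_finite : ∀ v : V, ∃ W : Submodule ℂ V, FiniteDimensional ℂ W ∧ ∀ κ, grp κ v ∈ W
  grp_deriv : ∀ (v : V) (ℓ : Module.Dual ℂ V),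
    HasDerivAt (fun θ : ℝ => ℓ (grp (rot θ) v)) (ℓ (lie rotGen v)) 0

namespace GKModule

variable {V : Type*} [AddCommGroup V] [Module ℂ V]

/-- A complex subspace is a `(𝔤, K)`-submodule if it is stable under `𝔤` and `K`. -/
structure IsSubmodule (ρ : GKModule V) (N : Submodule ℂ V) : Prop where
  lie_mem : ∀ (X : LieG), ∀ v ∈ N, ρ.lie X v ∈ N
  grp_mem : ∀ (κ : SO2), ∀ v ∈ N, ρ.grp κ v ∈ N

/-- The `(𝔤, K)`-module structure on a `(𝔤, K)`-submodule. -/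
def restrict (ρ : GKModule V) (N : Submodule ℂ V) (hN : ρ.IsSubmodule N) : GKModule N where
  lie :=
    { toFun := fun X => (ρ.lie X).restrict (hN.lie_mem X)
      map_add' := by intro X Y; ext v; simp
      map_smul' := by intro c X; ext v; simp }
  grp :=
    { toFun := fun κ => (ρ.grp κ).restrict (hN.grp_mem κ)
      map_one' := by ext v; simp
      map_mul' := by intro a b; ext v; simp }
  lie_bracket X Y v := by ext1; simp [ρ.lie_bracket]
  grp_lie κ X v := by ext1; simp [ρ.grp_lie]
  grp_finite v := by
    obtain ⟨W, hW, h⟩ := ρ.grp_finite v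
    refine ⟨W.comap N.subtype, ?_, fun κ => by simpa using h κ⟩
    exact Module.Finite.of_injective (N.subtype.restrict (p := W.comap N.subtype) (q := W)
      (fun x hx => hx)) (fun a b hab => by
        ext1; ext1; simpa using congrArg Subtype.val hab)
  grp_deriv v ℓ := by
    obtain ⟨ℓ', hℓ'⟩ := LinearMap.exists_extend ℓ
    have h := ρ.grp_deriv v ℓ'
    have e : ∀ w : N, ℓ' w = ℓ w := fun w => by rw [← hℓ']; rfl
    convert h using 1
    · funext θ; exact (e _).symm
    · exact (e _).symm

/-- The smallest `(𝔤, K)`-submodule containing `v`. -/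
def generated (ρ : GKModule V) (v : V) : Submodule ℂ V :=
  sInf {N | ρ.IsSubmodule N ∧ v ∈ N}

theorem isSubmodule_generated (ρ : GKModule V) (v : V) : ρ.IsSubmodule (ρ.generated v) where
  lie_mem X w hw := by
    rw [generated, Submodule.mem_sInf] at hw ⊢
    exact fun N hN => hN.1.lie_mem X w (hw N hN)
  grp_mem κ w hw := by
    rw [generated, Submodule.mem_sInf] at hw ⊢
    exact fun N hN => hN.1.grp_mem κ w (hw N hN)

theorem exists_coord (W : Submodule ℂ V) [FiniteDimensional ℂ W] :
    ∃ (n : ℕ) (e : Fin n → V) (c : Fin n → Module.Dual ℂ V),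
      ∀ w ∈ W, w = ∑ i, c i w • e i := by
  let b := Module.finBasis ℂ W
  have hex : ∀ i, ∃ g : Module.Dual ℂ V, g ∘ₗ W.subtype = b.coord i :=
    fun i => LinearMap.exists_extend (b.coord i)
  choose c hc using hex
  refine ⟨_, fun i => (b i : V), c, fun w hw => ?_⟩
  have h1 : ∀ i, c i w = b.repr ⟨w, hw⟩ i := fun i => by
    have := LinearMap.congr_fun (hc i) ⟨w, hw⟩
    simpa using this
  have h2 := congrArg Subtype.val (b.sum_repr ⟨w, hw⟩)
  simp only [h1]
  simpa only [AddSubmonoidClass.coe_finsetSum, Submodule.coe_smul] using h2.symm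

/-- The tensor product of two `(𝔤, K)`-modules, with the Leibniz action of `𝔤` and the diagonal
action of `K`. -/
noncomputable def tensor {M : Type*} [AddCommGroup M] [Module ℂ M] (ρ : GKModule V)
    (σ : GKModule M) : GKModule (V ⊗[ℂ] M) where
  lie :=
    { toFun := fun X => (ρ.lie X).rTensor M + (σ.lie X).lTensor V
      map_add' := by
        intro X Y
        ext v m
        simp only [map_add, TensorProduct.AlgebraTensorModule.curry_apply,
          LinearMap.restrictScalars_self, TensorProduct.curry_apply, LinearMap.add_apply,
          LinearMap.rTensor_tmul, LinearMap.lTensor_tmul, TensorProduct.add_tmul,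
          TensorProduct.tmul_add]
        abel
      map_smul' := by
        intro c X
        ext v m
        simp only [← Complex.coe_smul, map_smul, TensorProduct.AlgebraTensorModule.curry_apply,
          LinearMap.restrictScalars_self, TensorProduct.curry_apply, LinearMap.add_apply,
          LinearMap.rTensor_tmul, LinearMap.lTensor_tmul, LinearMap.smul_apply, RingHom.id_apply,
          TensorProduct.smul_tmul', TensorProduct.tmul_smul, smul_add] }
  grp :=
    { toFun := fun κ => TensorProduct.map (ρ.grp κ) (σ.grp κ)
      map_one' := by ext v m; simp
      map_mul' := by intro a b; ext v m; simp }
  lie_bracket X Y x := by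
    induction x with
    | zero => simp
    | add x y hx hy => simp only [map_add, hx, hy]; abel
    | tmul v m =>
      simp only [LinearMap.coe_mk, AddHom.coe_mk, LinearMap.add_apply, LinearMap.rTensor_tmul,
        LinearMap.lTensor_tmul, ρ.lie_bracket, σ.lie_bracket, map_add, TensorProduct.sub_tmul,
        TensorProduct.tmul_sub]
      abel
  grp_lie κ X x := by
    induction x with
    | zero => simp
    | add x y hx hy => simp only [map_add, hx, hy]
    | tmul v m => simp [ρ.grp_lie, σ.grp_lie]
  grp_finite x := by
    induction x with
    | zero => exact ⟨⊥, inferInstance, fun κ => by simp⟩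
    | add x y hx hy =>
      obtain ⟨W₁, _, h₁⟩ := hx
      obtain ⟨W₂, _, h₂⟩ := hy
      refine ⟨W₁ ⊔ W₂, inferInstance, fun κ => ?_⟩
      rw [map_add]
      exact Submodule.add_mem_sup (h₁ κ) (h₂ κ)
    | tmul v m =>
      obtain ⟨W₁, _, h₁⟩ := ρ.grp_finite v
      obtain ⟨W₂, _, h₂⟩ := σ.grp_finite m
      refine ⟨LinearMap.range (TensorProduct.map W₁.subtype W₂.subtype), inferInstance,
        fun κ => ⟨(⟨_, h₁ κ⟩ : W₁) ⊗ₜ (⟨_, h₂ κ⟩ : W₂), ?_⟩⟩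
      simp
  grp_deriv x ℓ := by
    induction x with
    | zero => simpa using hasDerivAt_const (0 : ℝ) (0 : ℂ)
    | add x y hx hy => simpa only [map_add] using! hx.add hy
    | tmul v m =>
      obtain ⟨W₁, _, h₁⟩ := ρ.grp_finite v
      obtain ⟨W₂, _, h₂⟩ := σ.grp_finite m
      obtain ⟨n₁, e, c, hc⟩ := exists_coord (W₁ ⊔ Submodule.span ℂ {ρ.lie rotGen v})
      obtain ⟨n₂, f, d, hd⟩ := exists_coord (W₂ ⊔ Submodule.span ℂ {σ.lie rotGen m})
      have h₁' : ∀ κ, ρ.grp κ v ∈ W₁ ⊔ Submodule.span ℂ {ρ.lie rotGen v} :=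
        fun κ => Submodule.mem_sup_left (h₁ κ)
      have h₂' : ∀ κ, σ.grp κ m ∈ W₂ ⊔ Submodule.span ℂ {σ.lie rotGen m} :=
        fun κ => Submodule.mem_sup_left (h₂ κ)
      have hX : ρ.lie rotGen v ∈ W₁ ⊔ Submodule.span ℂ {ρ.lie rotGen v} :=
        Submodule.mem_sup_right (Submodule.mem_span_singleton_self _)
      have hY : σ.lie rotGen m ∈ W₂ ⊔ Submodule.span ℂ {σ.lie rotGen m} :=
        Submodule.mem_sup_right (Submodule.mem_span_singleton_self _)
      have key : ∀ w ∈ W₁ ⊔ Submodule.span ℂ {ρ.lie rotGen v},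
          ∀ u ∈ W₂ ⊔ Submodule.span ℂ {σ.lie rotGen m},
          ℓ (w ⊗ₜ u) = ∑ i, ∑ j, c i w * d j u * ℓ (e i ⊗ₜ f j) := by
        intro w hw u hu
        conv_lhs => rw [hc w hw, hd u hu]
        simp only [TensorProduct.sum_tmul, TensorProduct.tmul_sum, map_sum,
          TensorProduct.tmul_smul, map_smul, smul_eq_mul, Finset.mul_sum]
        rw [Finset.sum_comm]
        refine Finset.sum_congr rfl fun i _ => Finset.sum_congr rfl fun j _ => ?_
        rw [← TensorProduct.smul_tmul', map_smul, smul_eq_mul]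
        ring
      have hv : v ∈ W₁ ⊔ Submodule.span ℂ {ρ.lie rotGen v} := by simpa using h₁' 1
      have hm : m ∈ W₂ ⊔ Submodule.span ℂ {σ.lie rotGen m} := by simpa using h₂' 1
      have r0 : rot 0 = 1 := by
        ext i j; fin_cases i <;> fin_cases j <;> simp [rot]
      have main : HasDerivAt (fun θ : ℝ => ∑ i, ∑ j, c i (ρ.grp (rot θ) v) * d j (σ.grp (rot θ) m)
          * ℓ (e i ⊗ₜ f j)) (∑ i, ∑ j, (c i (ρ.lie rotGen v) * d j m
            + c i v * d j (σ.lie rotGen m)) * ℓ (e i ⊗ₜ f j)) 0 := by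
        refine HasDerivAt.fun_sum fun i _ => HasDerivAt.fun_sum fun j _ => ?_
        have := ((ρ.grp_deriv v (c i)).mul (σ.grp_deriv m (d j))).mul_const (ℓ (e i ⊗ₜ f j))
        simpa [r0] using! this
      convert main using 1
      · funext θ
        simpa using key _ (h₁' (rot θ)) _ (h₂' (rot θ))
      · simp only [LinearMap.coe_mk, AddHom.coe_mk, LinearMap.add_apply, LinearMap.rTensor_tmul,
          LinearMap.lTensor_tmul, map_add]
        rw [key _ hX _ hm, key _ hv _ hY, ← Finset.sum_add_distrib]
        refine Finset.sum_congr rfl fun i _ => ?_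
        rw [← Finset.sum_add_distrib]
        exact Finset.sum_congr rfl fun j _ => by ring

/-! ### `(𝔤, K)`-cohomology -/

/-- The relative cochains `C^q = Hom_K (⋀^q (𝔤/𝔨), V)`: alternating `ℝ`-multilinear maps
`𝔤^q → V` which vanish as soon as one argument lies in `𝔨` and which are `K`-equivariant. -/
def cochain (ρ : GKModule V) (q : ℕ) : Submodule ℂ (LieG [⋀^Fin q]→ₗ[ℝ] V) where
  carrier := {ξ | (∀ x : Fin q → LieG, (∃ i, x i ∈ lieK) → ξ x = 0) ∧
    ∀ (κ : SO2) (x : Fin q → LieG), ξ (fun i => Ad κ (x i)) = ρ.grp κ (ξ x)}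
  zero_mem' := by simp
  add_mem' := by
    rintro a b ⟨ha, ha'⟩ ⟨hb, hb'⟩
    exact ⟨fun x hx => by simp [ha x hx, hb x hx], fun κ x => by simp [ha' κ x, hb' κ x]⟩
  smul_mem' := by
    rintro c a ⟨ha, ha'⟩
    exact ⟨fun x hx => by simp [ha x hx], fun κ x => by simp [ha' κ x]⟩

/-- The Chevalley–Eilenberg differential
`dξ(x₀, …, x_q) = ∑_j (-1)^j x_j · ξ(…, x̂_j, …) + ∑_{i<j} (-1)^{i+j} ξ([x_i, x_j], …, x̂_i, …, x̂_j, …)`.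
In the second sum the bracket `[x_i, x_j]` is put in the place of `x_i`, which absorbs the
sign `(-1)^i`. -/
def differential (ρ : GKModule V) (q : ℕ) :
    (LieG [⋀^Fin q]→ₗ[ℝ] V) →ₗ[ℂ] ((Fin (q + 1) → LieG) → V) where
  toFun ξ x := ∑ j : Fin (q + 1), (-1 : ℂ) ^ (j : ℕ) • (ρ.lie (x j) (ξ (j.removeNth x)) +
    ∑ i ∈ Finset.Iio j, ξ (j.removeNth (Function.update x i ⁅x i, x j⁆)))
  map_add' ξ η := by
    funext x
    simp only [AlternatingMap.add_apply, map_add, Finset.sum_add_distrib, smul_add, Pi.add_apply]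
    abel
  map_smul' c ξ := by
    funext x
    simp only [AlternatingMap.smul_apply, map_smul, RingHom.id_apply, Pi.smul_apply,
      Finset.smul_sum, smul_add, smul_comm c]

/-- An alternating map, regarded as a function. -/
def toFunLin (V : Type*) [AddCommGroup V] [Module ℂ V] (q : ℕ) :
    (LieG [⋀^Fin q]→ₗ[ℝ] V) →ₗ[ℂ] ((Fin q → LieG) → V) where
  toFun ξ x := ξ x
  map_add' _ _ := rfl
  map_smul' _ _ := rfl

/-- The cocycles `Z^q`. -/
def cocycle (ρ : GKModule V) (q : ℕ) : Submodule ℂ (LieG [⋀^Fin q]→ₗ[ℝ] V) :=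
  ρ.cochain q ⊓ LinearMap.ker (ρ.differential q)

/-- The coboundaries `B^q`: the cochains of the form `dη` with a cochain `η` of degree `q - 1`. -/
def coboundary (ρ : GKModule V) : (q : ℕ) → Submodule ℂ (LieG [⋀^Fin q]→ₗ[ℝ] V)
  | 0 => ⊥
  | q + 1 => ρ.cochain (q + 1) ⊓
      ((ρ.cochain q).map (ρ.differential q)).comap (toFunLin V (q + 1))

/-- The relative Lie algebra cohomology `H^q(𝔤, K; V) = Z^q / B^q`
(recall that `B^q ⊆ Z^q` as `d ∘ d = 0`). -/
abbrev cohomology (ρ : GKModule V) (q : ℕ) : Type _ :=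
  ρ.cocycle q ⧸ (ρ.coboundary q).submoduleOf (ρ.cocycle q)

/-- A `(𝔤, K)`-module `V` is cohomological if `H^q(𝔤, K; V ⊗ M) ≠ 0` for some `q` and some
finite-dimensional `(𝔤, K)`-module `M`. -/
def IsCohomological (ρ : GKModule V) : Prop :=
  ∃ (M : Type) (_ : AddCommGroup M) (_ : Module ℂ M) (σ : GKModule M) (q : ℕ),
    FiniteDimensional ℂ M ∧ Nontrivial ((ρ.tensor σ).cohomology q)

end GKModule

/-! ### The `(𝔤, K)`-module of smooth right `K`-finite functions on `G` -/

/-- The normed space of real `2 × 2` arrays (with the sup norm). -/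
abbrev Mat : Type := Fin 2 → Fin 2 → ℝ

/-- The open set `det > 0` of `2 × 2` arrays. -/
def detPos : Set Mat := {A | 0 < A 0 0 * A 1 1 - A 0 1 * A 1 0}

/-- The inclusion of `SL(2, ℝ)` into the space of `2 × 2` arrays. -/
def toMat (g : SL(2, ℝ)) : Mat := fun i j => g.1 i j

/-- A function on the closed submanifold `SL(2, ℝ)` of the space of real `2 × 2` matrices is smooth
if it is the restriction of a smooth function on the open set `det > 0`.  (A smooth `f` on
`SL(2, ℝ)` extends to `A ↦ f ((det A)^(-1/2) A)`.) -/
def IsSmooth (f : SL(2, ℝ) → ℂ) : Prop :=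
  ∃ F : Mat → ℂ, ContDiffOn ℝ ∞ F detPos ∧ ∀ g, F (toMat g) = f g

section ExpDet

attribute [local instance] Matrix.linftyOpNormedRing Matrix.linftyOpNormedAlgebra

theorem hasDerivAt_exp_entry (X : Matrix (Fin 2) (Fin 2) ℝ) (i j : Fin 2) (t : ℝ) :
    HasDerivAt (fun u : ℝ => NormedSpace.exp (u • X) i j)
      ((NormedSpace.exp (t • X) * X) i j) t := by
  have hc : Continuous (Matrix.entryLinearMap ℝ ℝ i j) :=
    LinearMap.continuous_of_finiteDimensional _
  let L : Matrix (Fin 2) (Fin 2) ℝ →L[ℝ] ℝ := ⟨Matrix.entryLinearMap ℝ ℝ i j, hc⟩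
  exact L.hasFDerivAt.comp_hasDerivAt t (hasDerivAt_exp_smul_const X t)

theorem matrix_exp_zero : NormedSpace.exp (0 : Matrix (Fin 2) (Fin 2) ℝ) = 1 :=
  NormedSpace.exp_zero

end ExpDet

theorem det_exp_eq_one (X : LieG) : (NormedSpace.exp X.1).det = 1 := by
  have htr : X.1 0 0 + X.1 1 1 = 0 := by
    have h : Matrix.trace X.1 = 0 := X.2
    simpa [Matrix.trace_fin_two] using h
  have hent := hasDerivAt_exp_entry X.1
  have hd : ∀ t : ℝ, HasDerivAt (fun u : ℝ => (NormedSpace.exp (u • X.1)).det) 0 t := by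
    intro t
    simp only [Matrix.det_fin_two]
    have h := ((hent 0 0 t).mul (hent 1 1 t)).sub ((hent 0 1 t).mul (hent 1 0 t))
    refine h.congr_deriv ?_
    simp only [Matrix.mul_apply, Fin.sum_univ_two]
    have : X.1 1 1 = -X.1 0 0 := by linarith
    rw [this]
    ring
  have hconst := is_const_of_deriv_eq_zero (fun t => (hd t).differentiableAt)
    (fun t => (hd t).deriv) 1 0
  simpa [matrix_exp_zero] using hconst

/-- The exponential map `𝔤 → G`. -/
noncomputable def expG (X : LieG) : SL(2, ℝ) := ⟨NormedSpace.exp X.1, det_exp_eq_one X⟩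

/-- The action of `X ∈ 𝔤` on functions on `G` by the left invariant vector field:
`(X f)(g) = d/dt f(g exp(tX))` at `t = 0`. -/
noncomputable def lieDeriv (X : LieG) (f : SL(2, ℝ) → ℂ) : SL(2, ℝ) → ℂ :=
  fun g => deriv (fun t : ℝ => f (g * expG (t • X))) 0

/-- Right translation `(R_h f)(g) = f(g h)`. -/
def rightTranslate (h : SL(2, ℝ)) (f : SL(2, ℝ) → ℂ) : SL(2, ℝ) → ℂ := fun g => f (g * h)

theorem isOpen_detPos : IsOpen detPos :=
  isOpen_lt continuous_const (by fun_prop)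

theorem toMat_mem (g : SL(2, ℝ)) : toMat g ∈ detPos := by
  have h := g.2
  rw [Matrix.det_fin_two] at h
  change 0 < g.1 0 0 * g.1 1 1 - g.1 0 1 * g.1 1 0
  rw [h]
  exact one_pos

/-- Right multiplication by a matrix. -/
noncomputable def mulR (X : Matrix (Fin 2) (Fin 2) ℝ) : Mat →L[ℝ] Mat :=
  LinearMap.toContinuousLinearMap
    { toFun := fun A i j => ∑ k, A i k * X k j
      map_add' := fun A B => by
        funext i j; simp only [Pi.add_apply, add_mul, Finset.sum_add_distrib]
      map_smul' := fun c A => by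
        funext i j
        simp only [Pi.smul_apply, smul_eq_mul, RingHom.id_apply, Finset.mul_sum, mul_assoc] }

theorem mulR_apply (X : Matrix (Fin 2) (Fin 2) ℝ) (A : Mat) (i j : Fin 2) :
    mulR X A i j = ∑ k, A i k * X k j := rfl

theorem mulR_add (X Y : Matrix (Fin 2) (Fin 2) ℝ) (A : Mat) :
    mulR (X + Y) A = mulR X A + mulR Y A := by
  funext i j
  simp [mulR_apply, mul_add, Finset.sum_add_distrib]

theorem mulR_sub (X Y : Matrix (Fin 2) (Fin 2) ℝ) (A : Mat) :
    mulR (X - Y) A = mulR X A - mulR Y A := by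
  funext i j
  simp [mulR_apply, mul_sub, Finset.sum_sub_distrib]

theorem mulR_smul (c : ℝ) (X : Matrix (Fin 2) (Fin 2) ℝ) (A : Mat) :
    mulR (c • X) A = c • mulR X A := by
  funext i j
  simp [mulR_apply, mul_left_comm, mul_add]

theorem mulR_mul (X Y : Matrix (Fin 2) (Fin 2) ℝ) (A : Mat) :
    mulR (X * Y) A = mulR Y (mulR X A) := by
  funext i j
  simp only [mulR_apply, Matrix.mul_apply, Fin.sum_univ_two]
  ring

theorem mulR_toMat (g h : SL(2, ℝ)) : mulR h.1 (toMat g) = toMat (g * h) := by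
  funext i j
  simp [mulR_apply, toMat, Matrix.mul_apply]

theorem mulR_mem (h : SL(2, ℝ)) {A : Mat} (hA : A ∈ detPos) : mulR h.1 A ∈ detPos := by
  have h1 := h.2
  rw [Matrix.det_fin_two] at h1
  have hA' : 0 < A 0 0 * A 1 1 - A 0 1 * A 1 0 := hA
  change 0 < mulR h.1 A 0 0 * mulR h.1 A 1 1 - mulR h.1 A 0 1 * mulR h.1 A 1 0
  simp only [mulR_apply, Fin.sum_univ_two]
  calc (0 : ℝ) < (A 0 0 * A 1 1 - A 0 1 * A 1 0) * (h.1 0 0 * h.1 1 1 - h.1 0 1 * h.1 1 0) := by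
        rw [h1, mul_one]; exact hA'
    _ = _ := by ring

theorem hasDerivAt_of_extension {F : Mat → ℂ} {f : SL(2, ℝ) → ℂ}
    (hF : ContDiffOn ℝ ∞ F detPos) (hf : ∀ g, F (toMat g) = f g) (X : LieG) (g : SL(2, ℝ))
    {c : ℝ → SL(2, ℝ)} (hc0 : c 0 = 1)
    (hc : ∀ i j, HasDerivAt (fun t => (c t).1 i j) (X.1 i j) 0) :
    HasDerivAt (fun t : ℝ => f (g * c t)) (fderiv ℝ F (toMat g) (mulR X.1 (toMat g))) 0 := by
  have h1 : HasDerivAt (fun t : ℝ => toMat (g * c t)) (mulR X.1 (toMat g)) 0 := by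
    rw [hasDerivAt_pi]
    intro i
    rw [hasDerivAt_pi]
    intro j
    simp only [toMat, mulR_apply, Matrix.SpecialLinearGroup.coe_mul, Matrix.mul_apply]
    exact HasDerivAt.fun_sum fun k _ => (hc k j).const_mul _
  have h2 : HasFDerivAt F (fderiv ℝ F (toMat g)) (toMat g) :=
    ((hF.contDiffAt (isOpen_detPos.mem_nhds (toMat_mem g))).differentiableAt
      (by simp)).hasFDerivAt
  have h3 : HasFDerivAt F (fderiv ℝ F (toMat g)) (toMat (g * c 0)) := by
    rwa [hc0, mul_one]
  have h4 := h3.comp_hasDerivAt (0 : ℝ) h1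
  have e : (fun t : ℝ => f (g * c t)) = F ∘ fun t => toMat (g * c t) := by
    funext t
    exact (hf (g * c t)).symm
  rw [e]
  exact h4

theorem hasDerivAt_expG (X : LieG) (i j : Fin 2) :
    HasDerivAt (fun t : ℝ => (expG (t • X)).1 i j) (X.1 i j) 0 := by
  have h := hasDerivAt_exp_entry X.1 i j 0
  rw [zero_smul, matrix_exp_zero, Matrix.one_mul] at h
  exact h

theorem expG_zero_smul (X : LieG) : expG ((0 : ℝ) • X) = 1 := by
  rw [zero_smul]
  exact Subtype.ext matrix_exp_zero

theorem lieDeriv_eq {F : Mat → ℂ} {f : SL(2, ℝ) → ℂ}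
    (hF : ContDiffOn ℝ ∞ F detPos) (hf : ∀ g, F (toMat g) = f g) (X : LieG) (g : SL(2, ℝ)) :
    lieDeriv X f g = fderiv ℝ F (toMat g) (mulR X.1 (toMat g)) :=
  (hasDerivAt_of_extension hF hf X g (expG_zero_smul X) (hasDerivAt_expG X)).deriv

theorem contDiffOn_ext {F : Mat → ℂ}
    (hF : ContDiffOn ℝ ∞ F detPos) (X : LieG) :
    ContDiffOn ℝ ∞ (fun A => fderiv ℝ F A (mulR X.1 A)) detPos := by
  have h1 : ContDiffOn ℝ ∞ (fderiv ℝ F) detPos :=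
    hF.fderiv_of_isOpen isOpen_detPos (by simp)
  exact h1.clm_apply (mulR X.1).contDiff.contDiffOn

theorem IsSmooth.lieDeriv {f : SL(2, ℝ) → ℂ} (hf : IsSmooth f) (X : LieG) :
    IsSmooth (lieDeriv X f) := by
  obtain ⟨F, hF, h⟩ := hf
  exact ⟨_, contDiffOn_ext hF X, fun g => (lieDeriv_eq hF h X g).symm⟩

theorem IsSmooth.rightTranslate {f : SL(2, ℝ) → ℂ} (hf : IsSmooth f) (h : SL(2, ℝ)) :
    IsSmooth (rightTranslate h f) := by
  obtain ⟨F, hF, hFf⟩ := hf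
  refine ⟨fun A => F (mulR h.1 A), hF.comp (mulR h.1).contDiff.contDiffOn
    (fun A hA => mulR_mem h hA), fun g => ?_⟩
  change F (mulR h.1 (toMat g)) = f (g * h)
  rw [← hFf (g * h), ← mulR_toMat]

theorem lieDeriv_add {f₁ f₂ : SL(2, ℝ) → ℂ} (h₁ : IsSmooth f₁) (h₂ : IsSmooth f₂) (X : LieG) :
    lieDeriv X (f₁ + f₂) = lieDeriv X f₁ + lieDeriv X f₂ := by
  obtain ⟨F₁, hF₁, e₁⟩ := h₁
  obtain ⟨F₂, hF₂, e₂⟩ := h₂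
  funext g
  have d₁ := hasDerivAt_of_extension hF₁ e₁ X g (expG_zero_smul X) (hasDerivAt_expG X)
  have d₂ := hasDerivAt_of_extension hF₂ e₂ X g (expG_zero_smul X) (hasDerivAt_expG X)
  have := (d₁.add d₂).deriv
  rw [Pi.add_apply, lieDeriv_eq hF₁ e₁, lieDeriv_eq hF₂ e₂]
  exact this

theorem lieDeriv_smul (c : ℂ) (f : SL(2, ℝ) → ℂ) (X : LieG) :
    lieDeriv X (c • f) = c • lieDeriv X f := by
  funext g
  exact deriv_const_smul_field (f := fun t : ℝ => f (g * expG (t • X))) c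

theorem lieDeriv_add_left {f : SL(2, ℝ) → ℂ} (hf : IsSmooth f) (X Y : LieG) :
    lieDeriv (X + Y) f = lieDeriv X f + lieDeriv Y f := by
  obtain ⟨F, hF, e⟩ := hf
  funext g
  simp [lieDeriv_eq hF e, mulR_add]

theorem lieDeriv_smul_left {f : SL(2, ℝ) → ℂ} (hf : IsSmooth f) (c : ℝ) (X : LieG) :
    lieDeriv (c • X) f = c • lieDeriv X f := by
  obtain ⟨F, hF, e⟩ := hf
  funext g
  simp [lieDeriv_eq hF e, mulR_smul]

theorem lieDeriv_bracket {f : SL(2, ℝ) → ℂ} (hf : IsSmooth f) (X Y : LieG) :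
    lieDeriv ⁅X, Y⁆ f = lieDeriv X (lieDeriv Y f) - lieDeriv Y (lieDeriv X f) := by
  obtain ⟨F, hF, e⟩ := hf
  funext g
  have hcd : ContDiffAt ℝ ∞ F (toMat g) := hF.contDiffAt (isOpen_detPos.mem_nhds (toMat_mem g))
  have hsymm : IsSymmSndFDerivAt ℝ F (toMat g) := hcd.isSymmSndFDerivAt (by
    rw [minSmoothness_of_isRCLikeNormedField]; exact WithTop.coe_le_coe.2 le_top)
  have hd : DifferentiableAt ℝ (fderiv ℝ F) (toMat g) :=
    ((hF.fderiv_of_isOpen isOpen_detPos (m := ∞) (by simp)).contDiffAt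
      (isOpen_detPos.mem_nhds (toMat_mem g))).differentiableAt (by simp)
  have key : ∀ X Y : LieG, lieDeriv X (lieDeriv Y f) g =
      fderiv ℝ (fderiv ℝ F) (toMat g) (mulR X.1 (toMat g)) (mulR Y.1 (toMat g))
        + fderiv ℝ F (toMat g) (mulR (X.1 * Y.1) (toMat g)) := by
    intro X Y
    rw [lieDeriv_eq (contDiffOn_ext hF Y) (fun g => (lieDeriv_eq hF e Y g).symm)]
    have hm : HasFDerivAt (fun A : Mat => mulR Y.1 A) (mulR Y.1) (toMat g) :=
      (mulR Y.1).hasFDerivAt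
    rw [(hd.hasFDerivAt.clm_apply hm).fderiv]
    simp [add_comm, mulR_mul]
  rw [Pi.sub_apply, key, key, lieDeriv_eq hF e,
    hsymm.eq (mulR X.1 (toMat g)) (mulR Y.1 (toMat g)),
    LieAlgebra.SpecialLinear.sl_bracket, mulR_sub, map_sub]
  ring

theorem rightTranslate_lieDeriv {f : SL(2, ℝ) → ℂ} (hf : IsSmooth f) (h : SL(2, ℝ)) (X : LieG) :
    rightTranslate h (lieDeriv X f) = lieDeriv (Ad h X) (rightTranslate h f) := by
  obtain ⟨F, hF, e⟩ := hf
  funext g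
  have d₁ := hasDerivAt_of_extension hF e X (g * h) (expG_zero_smul X) (hasDerivAt_expG X)
  have d₂ := hasDerivAt_of_extension (f := f) hF e X (g * h)
    (c := fun t => h⁻¹ * expG (t • Ad h X) * h)
    (by simp only [expG_zero_smul]; simp) (by
      intro i j
      have h0 : HasDerivAt (fun t : ℝ => ∑ l, (∑ k, h⁻¹.1 i k * (expG (t • Ad h X)).1 k l) * h.1 l j)
          (∑ l, (∑ k, h⁻¹.1 i k * (Ad h X).1 k l) * h.1 l j) 0 :=
        HasDerivAt.fun_sum fun l _ => HasDerivAt.mul_const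
          (HasDerivAt.fun_sum fun k _ => (hasDerivAt_expG (Ad h X) k l).const_mul _) _
      have h2 : (∑ l, (∑ k, h⁻¹.1 i k * (Ad h X).1 k l) * h.1 l j)
          = (h⁻¹.1 * (Ad h X).1 * h.1) i j := by simp only [Matrix.mul_apply]
      have h3 : (fun t : ℝ => ∑ l, (∑ k, h⁻¹.1 i k * (expG (t • Ad h X)).1 k l) * h.1 l j)
          = fun t => (h⁻¹ * expG (t • Ad h X) * h).1 i j := by
        funext t
        simp only [Matrix.SpecialLinearGroup.coe_mul, Matrix.mul_apply]
      rw [h2, h3] at h0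
      refine h0.congr_deriv (congrFun (congrFun ?_ i) j)
      have h1 : h⁻¹.1 * h.1 = 1 := by
        rw [← Matrix.SpecialLinearGroup.coe_mul, inv_mul_cancel, Matrix.SpecialLinearGroup.coe_one]
      calc h⁻¹.1 * (h.1 * X.1 * h⁻¹.1) * h.1 = (h⁻¹.1 * h.1) * X.1 * (h⁻¹.1 * h.1) := by
            simp only [Matrix.mul_assoc]
        _ = X.1 := by rw [h1, Matrix.one_mul, Matrix.mul_one])
  have : lieDeriv X f (g * h) = _ := d₁.deriv
  rw [rightTranslate, this, ← d₂.deriv, lieDeriv]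
  congr 1
  funext t
  simp [rightTranslate, mul_assoc]

/-- The space of smooth functions on `G` which are right `K`-finite, i.e. whose right translates
under `K` lie in a finite-dimensional space. -/
def smoothKFinite : Submodule ℂ (SL(2, ℝ) → ℂ) where
  carrier := {f | IsSmooth f ∧ ∃ W : Submodule ℂ (SL(2, ℝ) → ℂ), FiniteDimensional ℂ W ∧
    ∀ κ : SO2, rightTranslate κ f ∈ W}
  zero_mem' := ⟨⟨0, contDiffOn_const, fun _ => rfl⟩, ⊥, inferInstance, fun _ => rfl⟩
  add_mem' := by
    rintro f₁ f₂ ⟨⟨F₁, hF₁, e₁⟩, W₁, _, h₁⟩ ⟨⟨F₂, hF₂, e₂⟩, W₂, _, h₂⟩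
    refine ⟨⟨_, hF₁.add hF₂, fun g => by simp [e₁, e₂]⟩, W₁ ⊔ W₂, inferInstance, fun κ => ?_⟩
    exact Submodule.add_mem_sup (h₁ κ) (h₂ κ)
  smul_mem' := by
    rintro c f ⟨⟨F, hF, e⟩, W, hW, h⟩
    refine ⟨⟨_, hF.const_smul c, fun g => by simp [e]⟩, W, hW, fun κ => ?_⟩
    exact W.smul_mem c (h κ)

theorem lieDeriv_mem {f : SL(2, ℝ) → ℂ} (hf : f ∈ smoothKFinite) (X : LieG) :
    lieDeriv X f ∈ smoothKFinite := by
  obtain ⟨hs, W, hW, h⟩ := hf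
  refine ⟨hs.lieDeriv X, ?_⟩
  let b := Module.finBasis ℝ LieG
  -- the span of the translates consists of smooth functions
  let W' : Submodule ℂ (SL(2, ℝ) → ℂ) := Submodule.span ℂ (Set.range fun κ : SO2 =>
    rightTranslate κ f)
  have hW'W : W' ≤ W := Submodule.span_le.2 (by rintro _ ⟨κ, rfl⟩; exact h κ)
  have : FiniteDimensional ℂ W' := Submodule.finiteDimensional_of_le hW'W
  have hsm : ∀ w ∈ W', IsSmooth w := by
    intro w hw
    induction hw using Submodule.span_induction with
    | mem x hx => obtain ⟨κ, rfl⟩ := hx; exact hs.rightTranslate _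
    | zero => exact ⟨0, contDiffOn_const, fun _ => rfl⟩
    | add x y _ _ hx hy =>
      obtain ⟨F₁, hF₁, e₁⟩ := hx
      obtain ⟨F₂, hF₂, e₂⟩ := hy
      exact ⟨_, hF₁.add hF₂, fun g => by simp [e₁, e₂]⟩
    | smul c x _ hx =>
      obtain ⟨F, hF, e⟩ := hx
      exact ⟨_, hF.const_smul c, fun g => by simp [e]⟩
  let D : LieG → (W' →ₗ[ℂ] (SL(2, ℝ) → ℂ)) := fun Y =>
    { toFun := fun w => lieDeriv Y w
      map_add' := fun x y => lieDeriv_add (hsm _ x.2) (hsm _ y.2) Y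
      map_smul' := fun c x => lieDeriv_smul c _ Y }
  let S : Submodule ℂ (SL(2, ℝ) → ℂ) := ⨆ i, LinearMap.range (D (b i))
  refine ⟨S, Submodule.finiteDimensional_iSup _, fun κ => ?_⟩
  rw [rightTranslate_lieDeriv hs]
  have hw : rightTranslate κ f ∈ W' := Submodule.subset_span ⟨κ, rfl⟩
  have hsum : ∀ (s : Finset (Fin (Module.finrank ℝ LieG))) (a : Fin (Module.finrank ℝ LieG) → ℝ),
      lieDeriv (∑ i ∈ s, a i • b i) (rightTranslate κ f) ∈ S := by
    intro s a
    induction s using Finset.induction_on with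
    | empty =>
      have h0 := lieDeriv_smul_left (hsm _ hw) 0 0
      rw [Finset.sum_empty]
      simp only [zero_smul] at h0
      rw [h0]
      exact S.zero_mem
    | insert i s hi ih =>
      rw [Finset.sum_insert hi, lieDeriv_add_left (hsm _ hw), lieDeriv_smul_left (hsm _ hw)]
      refine S.add_mem ?_ ih
      rw [← Complex.coe_smul]
      refine S.smul_mem _ ?_
      exact (le_iSup (fun i => LinearMap.range (D (b i))) i) ⟨⟨_, hw⟩, rfl⟩
  have := hsum Finset.univ (fun i => b.repr (Ad κ X) i)
  rwa [b.sum_repr] at this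

theorem rightTranslate_mem {f : SL(2, ℝ) → ℂ} (hf : f ∈ smoothKFinite) (κ : SO2) :
    rightTranslate κ f ∈ smoothKFinite := by
  obtain ⟨hs, W, hW, h⟩ := hf
  refine ⟨hs.rightTranslate _, W, hW, fun κ' => ?_⟩
  have := h (κ' * κ)
  have e : rightTranslate ((κ' * κ : SO2) : SL(2, ℝ)) f
      = rightTranslate κ' (rightTranslate κ f) := by
    funext g; simp [rightTranslate, mul_assoc]
  rwa [e] at this

theorem exists_eval (W : Submodule ℂ (SL(2, ℝ) → ℂ)) [FiniteDimensional ℂ W]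
    (ℓ : Module.Dual ℂ W) : ∃ c : SL(2, ℝ) →₀ ℂ, ∀ w : W, ℓ w = c.sum fun g a => a * w.1 g := by
  let ev : SL(2, ℝ) → Module.Dual ℂ W := fun g => (LinearMap.proj g) ∘ₗ W.subtype
  have htop : Submodule.span ℂ (Set.range ev) = ⊤ := by
    apply Submodule.span_eq_top_of_ne_zero
    intro z hz
    by_contra! hcon
    apply hz
    ext g
    exact hcon (ev g) ⟨g, rfl⟩
  have hmem : ℓ ∈ Submodule.span ℂ (Set.range ev) := htop ▸ Submodule.mem_top
  obtain ⟨c, hc⟩ := (Finsupp.mem_span_range_iff_exists_finsupp).1 hmem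
  refine ⟨c, fun w => ?_⟩
  rw [← hc]
  simp [Finsupp.sum, ev]

theorem hasDerivAt_rot (i j : Fin 2) :
    HasDerivAt (fun θ : ℝ => ((rot θ : SO2) : SL(2, ℝ)).1 i j) (rotGen.1 i j) 0 := by
  have hc : HasDerivAt Real.cos 0 0 := by simpa using Real.hasDerivAt_cos 0
  have hs : HasDerivAt Real.sin 1 0 := by simpa using Real.hasDerivAt_sin 0
  fin_cases i <;> fin_cases j
  · exact hc
  · exact hs
  · exact hs.neg
  · exact hc

theorem rot_zero : rot 0 = 1 := by
  ext i j; fin_cases i <;> fin_cases j <;> simp [rot]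

/-- The `(𝔤, K)`-module of smooth right `K`-finite functions on `G`, where `𝔤` acts by left
invariant vector fields and `K` by right translation. -/
noncomputable def functionModule : GKModule smoothKFinite where
  lie :=
    { toFun := fun X =>
        { toFun := fun f => ⟨lieDeriv X f, lieDeriv_mem f.2 X⟩
          map_add' := fun f₁ f₂ => Subtype.ext (lieDeriv_add f₁.2.1 f₂.2.1 X)
          map_smul' := fun c f => Subtype.ext (lieDeriv_smul c f.1 X) }
      map_add' := fun X Y => LinearMap.ext fun f => Subtype.ext (lieDeriv_add_left f.2.1 X Y)
      map_smul' := fun c X => LinearMap.ext fun f => Subtype.ext (lieDeriv_smul_left f.2.1 c X) }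
  grp :=
    { toFun := fun κ =>
        { toFun := fun f => ⟨rightTranslate κ f, rightTranslate_mem f.2 κ⟩
          map_add' := fun _ _ => rfl
          map_smul' := fun _ _ => rfl }
      map_one' := LinearMap.ext fun f => Subtype.ext (by funext g; simp [rightTranslate])
      map_mul' := fun a b => LinearMap.ext fun f => Subtype.ext (by
        funext g
        change f.1 (g * (a * b : SO2)) = f.1 (g * a * b)
        rw [Subgroup.coe_mul, mul_assoc]) }
  lie_bracket X Y f := Subtype.ext (lieDeriv_bracket f.2.1 X Y)
  grp_lie κ X f := Subtype.ext (rightTranslate_lieDeriv f.2.1 κ X)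
  grp_finite f := by
    obtain ⟨hs, W, hW, h⟩ := f.2
    refine ⟨W.comap smoothKFinite.subtype, ?_, fun κ => h κ⟩
    exact Module.Finite.of_injective
      (smoothKFinite.subtype.restrict (p := W.comap smoothKFinite.subtype) (q := W)
      (fun x hx => hx)) (fun a b hab => by
        ext1; ext1; simpa using congrArg Subtype.val hab)
  grp_deriv f ℓ := by
    obtain ⟨hs, W, hW, h⟩ := f.2
    -- a finite-dimensional space of functions which contains everything in sight
    let W₁ : Submodule ℂ (SL(2, ℝ) → ℂ) :=
      (W ⊔ Submodule.span ℂ {lieDeriv rotGen f.1}) ⊓ smoothKFinite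
    have : FiniteDimensional ℂ W₁ := Submodule.finiteDimensional_of_le inf_le_left
    obtain ⟨c, hc⟩ := exists_eval W₁ (ℓ ∘ₗ Submodule.inclusion inf_le_right)
    have e : ∀ (w : smoothKFinite), w.1 ∈ W₁ → ℓ w = c.sum fun g a => a * w.1 g :=
      fun w hw => hc ⟨w.1, hw⟩
    obtain ⟨F, hF, hFf⟩ := hs
    have main : HasDerivAt (fun θ : ℝ => c.sum fun g a => a * f.1 (g * rot θ))
        (c.sum fun g a => a * lieDeriv rotGen f.1 g) 0 := by
      simp only [Finsupp.sum]
      refine HasDerivAt.fun_sum fun g _ => HasDerivAt.const_mul _ ?_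
      rw [lieDeriv_eq hF hFf]
      exact hasDerivAt_of_extension hF hFf rotGen g
        (c := fun θ => ((rot θ : SO2) : SL(2, ℝ))) (by simp [rot_zero]) hasDerivAt_rot
    convert main using 1
    · funext θ
      exact e _ ⟨Submodule.mem_sup_left (h (rot θ)), rightTranslate_mem f.2 _⟩
    · exact e _ ⟨Submodule.mem_sup_right (Submodule.mem_span_singleton_self _),
        lieDeriv_mem f.2 _⟩

/-! ### Weak harmonic Maass forms and mock modular forms -/

open UpperHalfPlane (ofComplex)

/-- The factor `c τ + d` for `γ = (a, b; c, d) ∈ SL(2, ℤ)`. -/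
noncomputable def autFactor (γ : SL(2, ℤ)) (τ : ℍ) : ℂ := (γ.1 1 0 : ℂ) * τ + (γ.1 1 1 : ℂ)

/-- `∂/∂u` for `z = u + i v`. -/
noncomputable def partialU (f : ℂ → ℂ) (z : ℂ) : ℂ := fderiv ℝ f z 1

/-- `∂/∂v` for `z = u + i v`. -/
noncomputable def partialV (f : ℂ → ℂ) (z : ℂ) : ℂ := fderiv ℝ f z Complex.I

/-- The weight `k` Laplace operator
`Δ_k = -v² (∂²/∂u² + ∂²/∂v²) + i k v (∂/∂u + i ∂/∂v)` on functions on the upper half plane. -/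
noncomputable def weightLaplacian (k : ℤ) (F : ℍ → ℂ) (τ : ℍ) : ℂ :=
  -(τ.im : ℂ) ^ 2 * (partialU (partialU (F ∘ ofComplex)) τ + partialV (partialV (F ∘ ofComplex)) τ)
    + Complex.I * k * τ.im *
      (partialU (F ∘ ofComplex) τ + Complex.I * partialV (F ∘ ofComplex) τ)

/-- `F` is a scalar-valued weak harmonic Maass form of weight `k` and type `χ` for the subgroup
`Γ` of `SL(2, ℤ)`, where `χ` is a one-dimensional complex representation of `Γ`. -/
structure IsHarmonicMaassForm (Γ : Subgroup SL(2, ℤ)) (χ : Γ →* ℂˣ) (k : ℤ) (F : ℍ → ℂ) :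
    Prop where
  smooth : ContDiffOn ℝ ∞ (F ∘ ofComplex) {z : ℂ | 0 < z.im}
  automorphy : ∀ (γ : Γ) (τ : ℍ), F ((γ : SL(2, ℤ)) • τ) = autFactor γ τ ^ k * χ γ * F τ
  /-- at most linear exponential growth at all cusps, uniformly in the real part -/
  growth : ∃ B > 0, ∀ σ : SL(2, ℤ), ∃ C R : ℝ, ∀ τ : ℍ, R ≤ τ.im →
    ‖autFactor σ τ ^ (-k) * F (σ • τ)‖ ≤ C * Real.exp (B * τ.im)
  harmonic : ∀ τ : ℍ, weightLaplacian k F τ = 0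

/-- The real-valued incomplete Gamma function `W_k(x) = Re Γ(1 - k, -2x)` for real `x ≠ 0`.  Here
`Γ(1 - k, z) = ∫_z^∞ w^(-k) e^(-w) dw` is integrated along the ray `w = z + (1 + i) t`, `t > 0`,
which avoids the origin; this is the principal branch, continued to negative real `z` from the upper
half plane.  For `x < 0` it is the usual integral over `[-2x, ∞)`. -/
noncomputable def incGammaW (k : ℤ) (x : ℝ) : ℝ :=
  (∫ t in Set.Ioi (0 : ℝ), (1 + Complex.I) *
    (((-2 * x : ℝ) : ℂ) + (1 + Complex.I) * t) ^ (-k) *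
      Complex.exp (-(((-2 * x : ℝ) : ℂ) + (1 + Complex.I) * t))).re

/-- `q^(n/h) = exp (2 π i n τ / h)`. -/
noncomputable def qExp (h : ℕ) (n : ℤ) (τ : ℂ) : ℂ :=
  Complex.exp (2 * Real.pi * Complex.I * n * τ / h)

/-- `Fp` is the holomorphic part of the weight `k` harmonic Maass form `F`: for some width `h ≥ 1`
there is a Fourier expansion `F = F⁺ + F⁻` with `F⁺ = Fp`,
`F⁺(τ) = ∑_{n ≫ -∞} c⁺(n) q^(n/h)` and
`F⁻(τ) = c⁻(0) v^(1-k) + ∑_{n ≪ ∞, n ≠ 0} c⁻(n) W_k(2 π n v / h) q^(n/h)`. -/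
def IsHolomorphicPart (k : ℤ) (F Fp : ℍ → ℂ) : Prop :=
  ∃ (h : ℕ) (cp cm : ℤ → ℂ) (N : ℤ), 0 < h ∧ (∀ n < -N, cp n = 0) ∧ (∀ n > N, cm n = 0) ∧
    ∀ τ : ℍ, HasSum (fun n : ℤ => cp n * qExp h n τ) (Fp τ) ∧
      HasSum (fun n : ℤ => if n = 0 then cm 0 * (τ.im : ℂ) ^ (1 - k)
        else cm n * incGammaW k (2 * Real.pi * n * τ.im / h) * qExp h n τ) (F τ - Fp τ)

/-- `Fp` is a mock modular form of weight `k ≠ 1`: the holomorphic part of a scalar-valued weak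
harmonic Maass form of weight `k` for a finite-index subgroup of `SL(2, ℤ)`. -/
def IsMockModularForm (k : ℤ) (Fp : ℍ → ℂ) : Prop :=
  k ≠ 1 ∧ ∃ (Γ : Subgroup SL(2, ℤ)) (χ : Γ →* ℂˣ) (F : ℍ → ℂ), Γ.FiniteIndex ∧
    IsHarmonicMaassForm Γ χ k F ∧ IsHolomorphicPart k F Fp

theorem norm_qExp (h : ℕ) (n : ℤ) (z : ℂ) :
    ‖qExp h n z‖ = Real.exp (-(2 * Real.pi * n / h) * z.im) := by
  rw [qExp, Complex.norm_exp]
  congr 1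
  have : 2 * (Real.pi : ℂ) * Complex.I * n * z / h
      = ((2 * Real.pi * n / h : ℝ) : ℂ) * (Complex.I * z) := by
    push_cast; ring
  rw [this, Complex.re_ofReal_mul]
  simp

theorem IsMockModularForm.differentiableOn {k : ℤ} {Fp : ℍ → ℂ} (hF : IsMockModularForm k Fp) :
    DifferentiableOn ℂ (Fp ∘ ofComplex) {z : ℂ | 0 < z.im} := by
  obtain ⟨-, Γ, χ, F, -, -, h, cp, cm, N, hh, -, -, hsum⟩ := hF
  intro z₀ hz₀
  have hz₀' : 0 < z₀.im := hz₀
  let s : Set ℂ := {z | z₀.im / 2 < z.im ∧ z.im < 2 * z₀.im}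
  have hs : IsOpen s := (isOpen_lt continuous_const Complex.continuous_im).inter
    (isOpen_lt Complex.continuous_im continuous_const)
  have hmem : z₀ ∈ s := ⟨by linarith, by linarith⟩
  have bound : ∀ y : ℝ, 0 < y →
      Summable fun n : ℤ => ‖cp n‖ * Real.exp (-(2 * Real.pi * n / h) * y) := by
    intro y hy
    have h1 := (hsum ⟨⟨0, y⟩, hy⟩).1.summable.norm
    simpa only [norm_mul, norm_qExp] using h1
  have hdiff := Complex.differentiableOn_tsum_of_summable_norm
    ((bound (z₀.im / 2) (by linarith)).add (bound (2 * z₀.im) (by linarith)))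
    (F := fun n z => cp n * qExp h n z) (U := s)
    (fun n => by unfold qExp; fun_prop) hs (by
      intro n w hw
      simp only [norm_mul, norm_qExp, ← mul_add]
      refine mul_le_mul_of_nonneg_left ?_ (norm_nonneg _)
      rcases le_total 0 (2 * Real.pi * n / h) with ha | ha
      · have : Real.exp (-(2 * Real.pi * n / h) * w.im)
            ≤ Real.exp (-(2 * Real.pi * n / h) * (z₀.im / 2)) :=
          Real.exp_le_exp.2 (by nlinarith [hw.1])
        linarith [Real.exp_pos (-(2 * Real.pi * n / h) * (2 * z₀.im))]
      · have : Real.exp (-(2 * Real.pi * n / h) * w.im)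
            ≤ Real.exp (-(2 * Real.pi * n / h) * (2 * z₀.im)) :=
          Real.exp_le_exp.2 (by nlinarith [hw.2])
        linarith [Real.exp_pos (-(2 * Real.pi * n / h) * (z₀.im / 2))])
  have hev : (Fp ∘ ofComplex) =ᶠ[nhds z₀] fun z => ∑' n, cp n * qExp h n z := by
    filter_upwards [hs.mem_nhds hmem] with z hz
    have hz' : 0 < z.im := by linarith [hz.1]
    have := (hsum ⟨z, hz'⟩).1.tsum_eq
    rw [Function.comp_apply, UpperHalfPlane.ofComplex_apply_of_im_pos hz']
    exact this.symm
  exact ((hdiff.differentiableAt (hs.mem_nhds hmem)).congr_of_eventuallyEq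
    hev).differentiableWithinAt

/-! ### The lift to `G` and the `(𝔤, K)`-module generated by it -/

/-- The lift `g ↦ (c i + d)^(-k) f(g i)`, `g = (a, b; c, d)`, of a function on the upper half plane
to `G = SL(2, ℝ)`. -/
noncomputable def liftG (k : ℤ) (f : ℍ → ℂ) (g : SL(2, ℝ)) : ℂ :=
  ((g.1 1 0 : ℂ) * Complex.I + (g.1 1 1 : ℂ)) ^ (-k) * f (g • UpperHalfPlane.I)

theorem isSmooth_liftG {f : ℍ → ℂ} (hf : DifferentiableOn ℂ (f ∘ ofComplex) {z : ℂ | 0 < z.im})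
    (k : ℤ) : IsSmooth (liftG k f) := by
  have hopen : IsOpen {z : ℂ | 0 < z.im} := isOpen_lt continuous_const Complex.continuous_im
  have hsm : ContDiffOn ℝ ∞ (f ∘ ofComplex) {z : ℂ | 0 < z.im} :=
    (hf.contDiffOn hopen).restrict_scalars ℝ
  have hent : ∀ i j : Fin 2, ContDiff ℝ ∞ (fun A : Mat => ((A i j : ℝ) : ℂ)) := fun i j =>
    Complex.ofRealCLM.contDiff.comp (contDiff_apply_apply ℝ ℝ i j)
  have hden : ContDiff ℝ ∞ (fun A : Mat => (A 1 0 : ℂ) * Complex.I + (A 1 1 : ℂ)) :=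
    ((hent 1 0).mul contDiff_const).add (hent 1 1)
  have hnum : ContDiff ℝ ∞ (fun A : Mat => (A 0 0 : ℂ) * Complex.I + (A 0 1 : ℂ)) :=
    ((hent 0 0).mul contDiff_const).add (hent 0 1)
  have hne : ∀ A ∈ detPos, (A 1 0 : ℂ) * Complex.I + (A 1 1 : ℂ) ≠ 0 := by
    intro A hA h0
    have h1 : A 1 1 = 0 := by simpa using congrArg Complex.re h0
    have h2 : A 1 0 = 0 := by simpa using congrArg Complex.im h0
    have hA' : 0 < A 0 0 * A 1 1 - A 0 1 * A 1 0 := hA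
    rw [h1, h2] at hA'
    simp at hA'
  have him : ∀ A ∈ detPos, 0 < (((A 0 0 : ℂ) * Complex.I + (A 0 1 : ℂ)) /
      ((A 1 0 : ℂ) * Complex.I + (A 1 1 : ℂ))).im := by
    intro A hA
    have hA' : 0 < A 0 0 * A 1 1 - A 0 1 * A 1 0 := hA
    have hn : 0 < Complex.normSq ((A 1 0 : ℂ) * Complex.I + (A 1 1 : ℂ)) :=
      Complex.normSq_pos.2 (hne A hA)
    rw [Complex.div_im, ← sub_div]
    refine div_pos ?_ hn
    simpa [mul_comm] using hA'
  refine ⟨fun A => ((A 1 0 : ℂ) * Complex.I + (A 1 1 : ℂ)) ^ (-k) * (f ∘ ofComplex)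
    (((A 0 0 : ℂ) * Complex.I + (A 0 1 : ℂ)) / ((A 1 0 : ℂ) * Complex.I + (A 1 1 : ℂ))), ?_, ?_⟩
  · refine ContDiffOn.mul ?_ (hsm.comp (g := f ∘ ofComplex) ?_ him)
    on_goal 2 =>
      simp only [div_eq_mul_inv]
      exact hnum.contDiffOn.mul (hden.contDiffOn.inv hne)
    rcases Int.eq_nat_or_neg (-k) with ⟨m, hm | hm⟩
    · simp only [hm, zpow_natCast]
      exact (hden.pow m).contDiffOn
    · simp only [hm, zpow_neg, zpow_natCast]
      exact (hden.pow m).contDiffOn.inv fun A hA => pow_ne_zero _ (hne A hA)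
  · intro g
    have hi := him (toMat g) (toMat_mem g)
    change _ * f (ofComplex _) = _ * f _
    rw [UpperHalfPlane.ofComplex_apply_of_im_pos hi, UpperHalfPlane.specialLinearGroup_apply]
    rfl

theorem SO2_entries (κ : SO2) : κ.1.1 1 1 = κ.1.1 0 0 ∧ κ.1.1 1 0 = -κ.1.1 0 1 := by
  have h : κ.1.1 * κ.1.1.transpose = 1 := κ.2
  have hd := κ.1.2
  have h00 := congrFun (congrFun h 0) 0
  have h01 := congrFun (congrFun h 0) 1
  have h11 := congrFun (congrFun h 1) 1
  rw [Matrix.det_fin_two] at hd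
  simp only [Matrix.mul_apply, Fin.sum_univ_two, Matrix.transpose_apply, Matrix.one_apply_eq] at h00 h11
  constructor
  · nlinarith [sq_nonneg (κ.1.1 1 1 - κ.1.1 0 0), sq_nonneg (κ.1.1 1 0 + κ.1.1 0 1)]
  · nlinarith [sq_nonneg (κ.1.1 1 1 - κ.1.1 0 0), sq_nonneg (κ.1.1 1 0 + κ.1.1 0 1)]

theorem SO2_smul_I (κ : SO2) : (κ : SL(2, ℝ)) • UpperHalfPlane.I = UpperHalfPlane.I := by
  obtain ⟨h1, h2⟩ := SO2_entries κ
  have hd := κ.1.2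
  rw [Matrix.det_fin_two] at hd
  ext1
  rw [UpperHalfPlane.specialLinearGroup_apply]
  change (((κ.1.1 0 0 : ℝ) : ℂ) * Complex.I + ((κ.1.1 0 1 : ℝ) : ℂ)) /
    (((κ.1.1 1 0 : ℝ) : ℂ) * Complex.I + ((κ.1.1 1 1 : ℝ) : ℂ)) = Complex.I
  have hne : ((κ.1.1 1 0 : ℝ) : ℂ) * Complex.I + ((κ.1.1 1 1 : ℝ) : ℂ) ≠ 0 := by
    intro h0
    have e1 : κ.1.1 1 1 = 0 := by simpa using congrArg Complex.re h0
    have e2 : κ.1.1 1 0 = 0 := by simpa using congrArg Complex.im h0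
    rw [e1, e2] at hd
    simp at hd
  rw [div_eq_iff hne, h1, h2]
  push_cast
  linear_combination (κ.1.1 0 1 : ℂ) * Complex.I_mul_I

theorem liftG_mem {f : ℍ → ℂ} (hf : DifferentiableOn ℂ (f ∘ ofComplex) {z : ℂ | 0 < z.im})
    (k : ℤ) : liftG k f ∈ smoothKFinite := by
  refine ⟨isSmooth_liftG hf k, Submodule.span ℂ {liftG k f}, inferInstance, fun κ => ?_⟩
  rw [Submodule.mem_span_singleton]
  refine ⟨((κ.1.1 1 0 : ℂ) * Complex.I + (κ.1.1 1 1 : ℂ)) ^ (-k), ?_⟩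
  funext g
  obtain ⟨h1, h2⟩ := SO2_entries κ
  have e : (((g * κ.1).1 1 0 : ℝ) : ℂ) * Complex.I + (((g * κ.1).1 1 1 : ℝ) : ℂ)
      = ((κ.1.1 1 0 : ℂ) * Complex.I + (κ.1.1 1 1 : ℂ)) *
        ((g.1 1 0 : ℂ) * Complex.I + (g.1 1 1 : ℂ)) := by
    simp only [Matrix.SpecialLinearGroup.coe_mul, Matrix.mul_apply, Fin.sum_univ_two]
    rw [h1, h2]
    push_cast
    linear_combination ((κ.1.1 0 1 : ℂ) * (g.1 1 0 : ℂ)) * Complex.I_mul_I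
  change _ * (_ * _) = _ ^ (-k) * f ((g * κ.1) • UpperHalfPlane.I)
  rw [mul_smul, SO2_smul_I, e, mul_zpow, mul_assoc]

/-- The lift to `G` of a mock modular form, as an element of the `(𝔤, K)`-module of smooth right
`K`-finite functions on `G`. -/
noncomputable def mockLift {k : ℤ} {Fp : ℍ → ℂ} (hF : IsMockModularForm k Fp) : smoothKFinite :=
  ⟨liftG k Fp, liftG_mem hF.differentiableOn k⟩

/-- The `(𝔤, K)`-module `V_{F⁺}` generated by (the lift of) a mock modular form `F⁺`. -/
noncomputable def mockModule {k : ℤ} {Fp : ℍ → ℂ} (hF : IsMockModularForm k Fp) :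
    GKModule (functionModule.generated (mockLift hF)) :=
  functionModule.restrict _ (functionModule.isSubmodule_generated (mockLift hF))

end MockModular

open MockModular

/-! The Fourier series of the mock modular form converges to a holomorphic function on the upper
half plane. Holomorphy means exactly that its lift `v` to G is killed by the lowering operator `L`
attached to `diagGen - i symGen`, and the factor `(ci+d)^(-k)` makes `v` a vector of K-weight `k`.
Let `R` be the raising operator. The commutation relation gives `L R^(j+1) v = -4(j+1)(k+j) R^j v`,
so the module generated by `v` is spanned by the vectors `R^j v`, of weights `k + 2j`: it is a
lowest weight module. From here on the argument is pure representation theory, with one cohomology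
class for each sign of `k`.

If `k ≤ 0`, the coefficient above vanishes at `j = -k`, so the `R^j v` with `j ≥ 1 - k` span a
submodule, and the quotient `Q` is finite-dimensional. Take `M` to be the dual of `Q`, and let `f`
in `M` be dual to the lowest weight vector. Then `v ⊗ f` is K-invariant and the evaluation pairing
`V ⊗ M → ℂ` is 𝔤-invariant and equals 1 on it. The area form on 𝔤/𝔨 with values in `v ⊗ f` is a
cocycle of top degree 2. The pairing kills every coboundary but not this class, so `H² ≠ 0`
(`nontrivial_cohomology_two`). For `k = 0` the functional that reads off the coefficient of `v` is
itself invariant, and no `M` is needed.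

If `k ≥ 2`, take `M` finite-dimensional of lowest weight `2 - k ≤ 0`, with lowest weight vector `m`.
Then `v ⊗ m` has weight 2 and is killed by `L`; these two facts say that it defines a 1-cocycle
supported on the raising direction. All weights of `V ⊗ M` are at least 2, so there are no
0-cochains and hence no coboundaries, and `H¹ ≠ 0` (`nontrivial_cohomology_one`). For `k = 2` the
same argument applies to `V` itself. At `k = 1` neither `k` nor `2 - k` is nonpositive. -/

namespace MockModular

/-! ### A basis of `𝔤` adapted to `𝔨` -/

/-- The diagonal matrix `diag(1, -1)`. -/
def diagGen : LieG :=
  ⟨!![1, 0; 0, -1], by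
    change Matrix.trace (_ : Matrix (Fin 2) (Fin 2) ℝ) = 0
    simp [Matrix.trace_fin_two]⟩

/-- The symmetric off-diagonal matrix `(0, 1; 1, 0)`. -/
def symGen : LieG :=
  ⟨!![0, 1; 1, 0], by
    change Matrix.trace (_ : Matrix (Fin 2) (Fin 2) ℝ) = 0
    simp [Matrix.trace_fin_two]⟩

/-- The entry `X i j` as a linear functional on `𝔤`. -/
def entry (i j : Fin 2) : LieG →ₗ[ℝ] ℝ where
  toFun X := X.1 i j
  map_add' _ _ := rfl
  map_smul' _ _ := rfl

/-- The coordinate along `rotGen`. -/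
noncomputable def coordE : LieG →ₗ[ℝ] ℝ := (1 / 2 : ℝ) • (entry 0 1 - entry 1 0)

/-- The coordinate along `diagGen`. -/
def coordA : LieG →ₗ[ℝ] ℝ := entry 0 0

/-- The coordinate along `symGen`. -/
noncomputable def coordB : LieG →ₗ[ℝ] ℝ := (1 / 2 : ℝ) • (entry 0 1 + entry 1 0)

theorem coordE_apply (X : LieG) : coordE X = (X.1 0 1 - X.1 1 0) / 2 := by
  change (1 / 2 : ℝ) * (X.1 0 1 - X.1 1 0) = _
  ring

theorem coordA_apply (X : LieG) : coordA X = X.1 0 0 := rfl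

theorem coordB_apply (X : LieG) : coordB X = (X.1 0 1 + X.1 1 0) / 2 := by
  change (1 / 2 : ℝ) * (X.1 0 1 + X.1 1 0) = _
  ring

theorem entry_one_one (X : LieG) : X.1 1 1 = -X.1 0 0 := by
  have h : Matrix.trace X.1 = 0 := X.2
  rw [Matrix.trace_fin_two] at h
  linarith

theorem eq_coord (X : LieG) :
    X = coordE X • rotGen + coordA X • diagGen + coordB X • symGen := by
  ext i j
  have h := entry_one_one X
  fin_cases i <;> fin_cases j <;>
    simp [coordE_apply, coordA_apply, coordB_apply, rotGen, diagGen, symGen, h] <;> ring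

theorem bracket_entry (X Y : LieG) (i j : Fin 2) :
    (⁅X, Y⁆ : LieG).1 i j = (X.1 * Y.1 - Y.1 * X.1) i j := by
  rw [LieAlgebra.SpecialLinear.sl_bracket]

/-- The Cartan decomposition 𝔤 = 𝔨 ⊕ 𝔭 in coordinates. With all three bracket formulas available,
cocycle identities become polynomial identities in coordinates. -/
theorem coordE_bracket (X Y : LieG) :
    coordE ⁅X, Y⁆ = 2 * (coordA X * coordB Y - coordB X * coordA Y) := by
  simp only [coordE_apply, coordA_apply, coordB_apply, bracket_entry, Matrix.sub_apply,
    Matrix.mul_apply, Fin.sum_univ_two, entry_one_one]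
  ring

theorem coordA_bracket (X Y : LieG) :
    coordA ⁅X, Y⁆ = 2 * (coordE X * coordB Y - coordB X * coordE Y) := by
  simp only [coordE_apply, coordA_apply, coordB_apply, bracket_entry, Matrix.sub_apply,
    Matrix.mul_apply, Fin.sum_univ_two]
  ring

theorem coordB_bracket (X Y : LieG) :
    coordB ⁅X, Y⁆ = -2 * (coordE X * coordA Y - coordA X * coordE Y) := by
  simp only [coordE_apply, coordA_apply, coordB_apply, bracket_entry, Matrix.sub_apply,
    Matrix.mul_apply, Fin.sum_univ_two, entry_one_one]
  ring

theorem coord_gens :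
    (coordE rotGen = 1 ∧ coordA rotGen = 0 ∧ coordB rotGen = 0) ∧
    (coordE diagGen = 0 ∧ coordA diagGen = 1 ∧ coordB diagGen = 0) ∧
    (coordE symGen = 0 ∧ coordA symGen = 0 ∧ coordB symGen = 1) := by
  simp [coordE_apply, coordA_apply, coordB_apply, rotGen, diagGen, symGen]

theorem bracket_diagGen_symGen : ⁅diagGen, symGen⁆ = (2 : ℝ) • rotGen := by
  rw [eq_coord ⁅diagGen, symGen⁆, coordE_bracket, coordA_bracket, coordB_bracket]
  simp [coord_gens]

theorem mem_lieK_iff {X : LieG} : X ∈ lieK ↔ coordA X = 0 ∧ coordB X = 0 := by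
  change X.1.transpose = -X.1 ↔ _
  rw [coordA_apply, coordB_apply]
  constructor
  · intro h
    have h0 := congrFun (congrFun h 0) 0
    have h1 := congrFun (congrFun h 0) 1
    simp only [Matrix.transpose_apply, Matrix.neg_apply] at h0 h1
    constructor <;> linarith
  · rintro ⟨h0, h1⟩
    have := entry_one_one X
    ext i j
    fin_cases i <;> fin_cases j <;> simp <;> linarith

/-! ### The circle K and its adjoint action -/

theorem exists_rot (κ : SO2) : ∃ θ, κ = rot θ := by
  obtain ⟨h1, h2⟩ := SO2_entries κ
  have hd := κ.1.2
  rw [Matrix.det_fin_two, h1, h2] at hd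
  have hn : ‖(⟨κ.1.1 0 0, κ.1.1 0 1⟩ : ℂ)‖ = 1 := by
    rw [Complex.norm_def, Complex.normSq_mk, Real.sqrt_eq_one]
    linarith
  refine ⟨Complex.arg ⟨κ.1.1 0 0, κ.1.1 0 1⟩, ?_⟩
  have hne : (⟨κ.1.1 0 0, κ.1.1 0 1⟩ : ℂ) ≠ 0 := by
    intro h
    rw [h, norm_zero] at hn
    exact zero_ne_one hn
  ext i j
  fin_cases i <;> fin_cases j <;>
    simp [rot, Complex.cos_arg hne, Complex.sin_arg, hn, h1, h2]

theorem rot_inv_entries (θ : ℝ) :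
    ((rot θ : SO2) : SL(2, ℝ))⁻¹.1 = !![Real.cos θ, -Real.sin θ; Real.sin θ, Real.cos θ] := by
  rw [Matrix.SpecialLinearGroup.coe_inv, Matrix.adjugate_fin_two]
  simp [rot]

/-- K fixes 𝔨 and acts on 𝔭 by a rotation through `2θ`. The doubled angle is why raising and
lowering change weights by 2. -/
theorem coord_Ad_rot (θ : ℝ) (X : LieG) :
    coordA (Ad (rot θ) X) = Real.cos (2 * θ) * coordA X + Real.sin (2 * θ) * coordB X ∧
    coordB (Ad (rot θ) X) = -Real.sin (2 * θ) * coordA X + Real.cos (2 * θ) * coordB X ∧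
    coordE (Ad (rot θ) X) = coordE X := by
  have e : (Ad (rot θ) X).1 = !![Real.cos θ, Real.sin θ; -Real.sin θ, Real.cos θ] * X.1 *
      !![Real.cos θ, -Real.sin θ; Real.sin θ, Real.cos θ] := by
    rw [← rot_inv_entries]; rfl
  have h := entry_one_one X
  have h2 := Real.sin_sq_add_cos_sq θ
  simp only [coordA_apply, coordB_apply, coordE_apply, e, Real.cos_two_mul', Real.sin_two_mul,
    Matrix.mul_apply, Fin.sum_univ_two, Matrix.of_apply, Matrix.cons_val', Matrix.cons_val_zero,
    Matrix.cons_val_one, Matrix.cons_val_fin_one, h]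
  refine ⟨by ring, by ring, ?_⟩
  linear_combination (X.1 0 1 - X.1 1 0) / 2 * h2

theorem Ad_rot_diagGen (θ : ℝ) :
    Ad (rot θ) diagGen = Real.cos (2 * θ) • diagGen - Real.sin (2 * θ) • symGen := by
  obtain ⟨h1, h2, h3⟩ := coord_Ad_rot θ diagGen
  rw [eq_coord (Ad (rot θ) diagGen), h1, h2, h3]
  simp [coord_gens, sub_eq_add_neg]

theorem Ad_rot_symGen (θ : ℝ) :
    Ad (rot θ) symGen = Real.sin (2 * θ) • diagGen + Real.cos (2 * θ) • symGen := by
  obtain ⟨h1, h2, h3⟩ := coord_Ad_rot θ symGen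
  rw [eq_coord (Ad (rot θ) symGen), h1, h2, h3]
  simp [coord_gens]

namespace GKModule

variable {V : Type*} [AddCommGroup V] [Module ℂ V] (ρ : GKModule V)

/-! ### Raising and lowering operators, weight vectors -/

/-- The raising operator. -/
noncomputable def raise : Module.End ℂ V := ρ.lie diagGen + Complex.I • ρ.lie symGen

/-- The lowering operator. -/
noncomputable def lower : Module.End ℂ V := ρ.lie diagGen - Complex.I • ρ.lie symGen

theorem raise_apply (v : V) : ρ.raise v = ρ.lie diagGen v + Complex.I • ρ.lie symGen v := rfl

theorem lower_apply (v : V) : ρ.lower v = ρ.lie diagGen v - Complex.I • ρ.lie symGen v := rfl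

theorem lie_eq_coord (X : LieG) (v : V) :
    ρ.lie X v = (coordE X : ℂ) • ρ.lie rotGen v + (coordA X : ℂ) • ρ.lie diagGen v +
      (coordB X : ℂ) • ρ.lie symGen v := by
  conv_lhs => rw [eq_coord X]
  simp only [map_add, map_smul, LinearMap.add_apply, LinearMap.smul_apply, Complex.coe_smul]

/-- Reduces every statement about 𝔤 to `rotGen`, `raise` and `lower`, whose effect on weight vectors
is explicit. -/
theorem lie_eq_raise_lower (X : LieG) (v : V) :
    ρ.lie X v = (coordE X : ℂ) • ρ.lie rotGen v +
      ((coordA X - Complex.I * coordB X) / 2 : ℂ) • ρ.raise v +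
      ((coordA X + Complex.I * coordB X) / 2 : ℂ) • ρ.lower v := by
  rw [lie_eq_coord, raise_apply, lower_apply]
  match_scalars
  · ring
  · ring
  · linear_combination (coordB X : ℂ) * Complex.I_sq

theorem lower_raise (v : V) :
    ρ.lower (ρ.raise v) = ρ.raise (ρ.lower v) + (4 * Complex.I) • ρ.lie rotGen v := by
  have h1 := ρ.lie_bracket diagGen symGen v
  rw [bracket_diagGen_symGen, map_smul, LinearMap.smul_apply, ← Complex.coe_smul] at h1
  push_cast at h1
  simp only [raise_apply, lower_apply, map_add, map_sub, map_smul]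
  rw [eq_add_of_sub_eq h1.symm]
  match_scalars <;> ring

/-- `v` has weight `n` if `rot θ` acts on it by `exp(i n θ)`. -/
def HasWeight (n : ℤ) (v : V) : Prop :=
  ∀ θ : ℝ, ρ.grp (rot θ) v = Complex.exp (n * θ * Complex.I) • v

variable {ρ}

/-- Differentiate the character `exp(inθ)` at 0. As `grp_deriv` is stated through linear
functionals, the equality is tested on all of them. -/
theorem HasWeight.rotGen {n : ℤ} {v : V} (hv : ρ.HasWeight n v) :
    ρ.lie rotGen v = (n * Complex.I) • v := by
  rw [← sub_eq_zero, ← Module.forall_dual_apply_eq_zero_iff ℂ]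
  intro ℓ
  rw [map_sub, sub_eq_zero]
  refine (ρ.grp_deriv v ℓ).unique ?_
  simp only [hv _, map_smul, smul_eq_mul]
  refine HasDerivAt.mul_const ?_ _
  have h : HasDerivAt (fun θ : ℝ => (n : ℂ) * θ * Complex.I) (n * 1 * Complex.I) 0 :=
    ((Complex.ofRealCLM.hasDerivAt (x := (0 : ℝ))).const_mul (n : ℂ)).mul_const Complex.I
  simpa using h.cexp

theorem HasWeight.raise {n : ℤ} {v : V} (hv : ρ.HasWeight n v) :
    ρ.HasWeight (n + 2) (ρ.raise v) := by
  intro θ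
  rw [raise_apply, map_add, map_smul, ρ.grp_lie, ρ.grp_lie, hv θ, Ad_rot_diagGen, Ad_rot_symGen]
  have e : Complex.exp (((n + 2 : ℤ) : ℂ) * θ * Complex.I) = Complex.exp (n * θ * Complex.I) *
      (Real.cos (2 * θ) + Real.sin (2 * θ) * Complex.I) := by
    rw [Complex.ofReal_cos, Complex.ofReal_sin, ← Complex.exp_mul_I, ← Complex.exp_add]
    congr 1
    push_cast
    ring
  rw [e]
  generalize Real.cos (2 * θ) = c
  generalize Real.sin (2 * θ) = s
  simp only [map_add, map_sub, map_smul, LinearMap.add_apply, LinearMap.sub_apply,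
    LinearMap.smul_apply, ← Complex.coe_smul]
  match_scalars
  · ring
  · linear_combination -(Complex.exp (n * θ * Complex.I) * s) * Complex.I_sq

theorem HasWeight.pow_raise {n : ℤ} {v : V} (hv : ρ.HasWeight n v) (j : ℕ) :
    ρ.HasWeight (n + 2 * j) ((ρ.raise ^ j) v) := by
  induction j with
  | zero => simpa using hv
  | succ j ih =>
    rw [pow_succ', Module.End.mul_apply]
    convert ih.raise using 1
    push_cast; ring

/-- Moving `lower` past each `raise` contributes `-4` times the current weight, and the weights `n,
n+2, …, n+2j` add up to `(j+1)(n+j)`. The zero of this coefficient at `j = -n` is what produces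
finite-dimensional quotients. -/
theorem HasWeight.lower_pow_raise {n : ℤ} {v : V} (hv : ρ.HasWeight n v) (hl : ρ.lower v = 0)
    (j : ℕ) : ρ.lower ((ρ.raise ^ (j + 1)) v) =
      (-4 * (j + 1) * (n + j) : ℂ) • (ρ.raise ^ j) v := by
  induction j with
  | zero =>
    rw [zero_add, pow_one, lower_raise, hl, hv.rotGen, map_zero, pow_zero, Module.End.one_apply]
    match_scalars
    linear_combination (4 * n : ℂ) * Complex.I_sq
  | succ j ih =>
    rw [pow_succ', Module.End.mul_apply, lower_raise, ih, map_smul, (hv.pow_raise (j + 1)).rotGen,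
      ← Module.End.mul_apply, ← pow_succ']
    match_scalars
    linear_combination (4 * (n + 2 * (j + 1)) : ℂ) * Complex.I_sq

/-- An eigenvector in the span of eigenvectors with other eigenvalues vanishes. -/
theorem eq_zero_of_mem_span_eigenvectors {f : Module.End ℂ V} {S : Set V} {μ : ℂ}
    (hS : ∀ s ∈ S, ∃ ν ≠ μ, f s = ν • s) {v : V} (hv : v ∈ Submodule.span ℂ S)
    (hfv : f v = μ • v) : v = 0 := by
  have hle : Submodule.span ℂ S ≤ ⨆ ν, ⨆ (_ : ν ≠ μ), f.eigenspace ν := by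
    refine Submodule.span_le.2 fun s hs => ?_
    obtain ⟨ν, hν, h⟩ := hS s hs
    exact Submodule.mem_iSup_of_mem ν (Submodule.mem_iSup_of_mem hν
      (Module.End.mem_eigenspace_iff.2 h))
  exact Submodule.disjoint_def.1 (f.eigenspaces_iSupIndep μ) v
    (Module.End.mem_eigenspace_iff.2 hfv) (hle hv)

end GKModule

namespace GKModule

variable {V : Type*} [AddCommGroup V] [Module ℂ V] {ρ : GKModule V}

/-! ### Nonvanishing criteria for cohomology -/

theorem nontrivial_cohomology {q : ℕ} {ξ : LieG [⋀^Fin q]→ₗ[ℝ] V} (h : ξ ∈ ρ.cocycle q)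
    (h' : ξ ∉ ρ.coboundary q) : Nontrivial (ρ.cohomology q) := by
  rw [Submodule.Quotient.nontrivial_iff]
  intro htop
  have : (⟨ξ, h⟩ : ρ.cocycle q) ∈ (ρ.coboundary q).submoduleOf (ρ.cocycle q) :=
    htop ▸ Submodule.mem_top
  exact h' this

theorem differential_apply (q : ℕ) (ξ : LieG [⋀^Fin q]→ₗ[ℝ] V) (x : Fin (q + 1) → LieG) :
    ρ.differential q ξ x = ∑ j : Fin (q + 1), (-1 : ℂ) ^ (j : ℕ) •
      (ρ.lie (x j) (ξ (j.removeNth x)) +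
        ∑ i ∈ Finset.Iio j, ξ (j.removeNth (Function.update x i ⁅x i, x j⁆))) := rfl

theorem differential_one (ξ : LieG [⋀^Fin 1]→ₗ[ℝ] V) (x : Fin 2 → LieG) :
    ρ.differential 1 ξ x = ρ.lie (x 0) (ξ ![x 1]) - ρ.lie (x 1) (ξ ![x 0]) -
      ξ ![⁅x 0, x 1⁆] := by
  have e0 : (0 : Fin 2).removeNth x = ![x 1] := by
    funext i; fin_cases i; rfl
  have e1 : (1 : Fin 2).removeNth x = ![x 0] := by
    funext i; fin_cases i; rfl
  have e2 : (1 : Fin 2).removeNth (Function.update x 0 ⁅x 0, x 1⁆) = ![⁅x 0, x 1⁆] := by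
    funext i; fin_cases i; rfl
  have hI0 : Finset.Iio (0 : Fin 2) = ∅ := by decide
  have hI1 : Finset.Iio (1 : Fin 2) = {0} := by decide
  rw [differential_apply]
  refine (Fin.sum_univ_two _).trans ?_
  rw [hI0, hI1, Finset.sum_empty, Finset.sum_singleton, e0, e1, e2]
  simp
  abel

theorem differential_two (ξ : LieG [⋀^Fin 2]→ₗ[ℝ] V) (x : Fin 3 → LieG) :
    ρ.differential 2 ξ x = ρ.lie (x 0) (ξ ![x 1, x 2]) - ρ.lie (x 1) (ξ ![x 0, x 2]) +
      ρ.lie (x 2) (ξ ![x 0, x 1]) - ξ ![⁅x 0, x 1⁆, x 2] + ξ ![⁅x 0, x 2⁆, x 1] +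
      ξ ![x 0, ⁅x 1, x 2⁆] := by
  have e0 : (0 : Fin 3).removeNth x = ![x 1, x 2] := by
    funext i; fin_cases i <;> rfl
  have e1 : (1 : Fin 3).removeNth x = ![x 0, x 2] := by
    funext i; fin_cases i <;> rfl
  have e2 : (2 : Fin 3).removeNth x = ![x 0, x 1] := by
    funext i; fin_cases i <;> rfl
  have f1 : (1 : Fin 3).removeNth (Function.update x 0 ⁅x 0, x 1⁆) = ![⁅x 0, x 1⁆, x 2] := by
    funext i; fin_cases i <;> rfl
  have f2 : (2 : Fin 3).removeNth (Function.update x 0 ⁅x 0, x 2⁆) = ![⁅x 0, x 2⁆, x 1] := by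
    funext i; fin_cases i <;> rfl
  have f3 : (2 : Fin 3).removeNth (Function.update x 1 ⁅x 1, x 2⁆) = ![x 0, ⁅x 1, x 2⁆] := by
    funext i; fin_cases i <;> rfl
  have hI0 : Finset.Iio (0 : Fin 3) = ∅ := by decide
  have hI1 : Finset.Iio (1 : Fin 3) = {0} := by decide
  have hI2 : Finset.Iio (2 : Fin 3) = {0, 1} := by decide
  rw [differential_apply]
  refine (Fin.sum_univ_three _).trans ?_
  rw [hI0, hI1, hI2, Finset.sum_empty, Finset.sum_singleton,
    Finset.sum_pair (by decide), e0, e1, e2, f1, f2, f3]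
  simp
  abel

/-- The 2-cochain `x ∧ y ↦ det(x, y) • w` on `𝔤/𝔨`. -/
noncomputable def areaCochain (w : V) : LieG [⋀^Fin 2]→ₗ[ℝ] V :=
  (LinearMap.toSpanSingleton ℝ V w).compAlternatingMap
    ((Matrix.detRowAlternating (n := Fin 2) (R := ℝ)).compLinearMap
      (LinearMap.pi ![coordA, coordB]))

theorem areaCochain_apply (w : V) (x : Fin 2 → LieG) :
    areaCochain w x =
      ((coordA (x 0) * coordB (x 1) - coordB (x 0) * coordA (x 1) : ℝ) : ℂ) • w := by
  rw [Complex.coe_smul]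
  exact congrArg (fun c : ℝ => c • w) (Matrix.det_fin_two _)

/-- K acts on 𝔭 by rotations, which preserve area, so a K-invariant value gives an equivariant form.
It is closed because 𝔤/𝔨 has dimension 2. -/
theorem areaCochain_mem_cocycle {w : V} (hw : ρ.HasWeight 0 w) :
    areaCochain w ∈ ρ.cocycle 2 := by
  refine ⟨⟨fun x hx => ?_, fun κ x => ?_⟩, ?_⟩
  · rw [areaCochain_apply]
    obtain ⟨i, hi⟩ := hx
    rw [mem_lieK_iff] at hi
    fin_cases i <;> simp at hi <;> simp [hi]
  · obtain ⟨θ, rfl⟩ := exists_rot κ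
    rw [areaCochain_apply, areaCochain_apply, map_smul, hw θ]
    obtain ⟨h1, h2, -⟩ := coord_Ad_rot θ (x 0)
    obtain ⟨h3, h4, -⟩ := coord_Ad_rot θ (x 1)
    have h5 := Real.sin_sq_add_cos_sq (2 * θ)
    rw [h1, h2, h3, h4, Int.cast_zero, zero_mul, zero_mul, Complex.exp_zero, one_smul]
    congr 2
    linear_combination (coordA (x 0) * coordB (x 1) - coordB (x 0) * coordA (x 1)) * h5
  · rw [SetLike.mem_coe, LinearMap.mem_ker]
    funext x
    have h0 : ρ.lie rotGen w = 0 := by simpa using hw.rotGen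
    -- Since 𝔨 kills `w`, only two vectors `p`, `r` occur in the differential, and their
    -- coefficients cancel as polynomials in the coordinates.
    obtain ⟨p, r, hX⟩ : ∃ p r : V, ∀ X, ρ.lie X w = (coordA X : ℂ) • p + (coordB X : ℂ) • r :=
      ⟨_, _, fun X => by rw [lie_eq_coord, h0, smul_zero, zero_add]⟩
    simp only [differential_two, areaCochain_apply, map_smul, hX, Pi.zero_apply,
      Matrix.cons_val_zero, Matrix.cons_val_one, coordA_bracket, coordB_bracket]
    match_scalars <;> ring

/-- If `w` is `K`-invariant and not killed by some `𝔤`-invariant functional, then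
`H²(𝔤, K; V) ≠ 0`. -/
theorem nontrivial_cohomology_two {w : V} (hw : ρ.HasWeight 0 w) (ε : Module.Dual ℂ V)
    (hε : ∀ X v, ε (ρ.lie X v) = 0) (hεw : ε w ≠ 0) : Nontrivial (ρ.cohomology 2) := by
  refine nontrivial_cohomology (areaCochain_mem_cocycle hw) ?_
  rintro ⟨-, η, hη, h⟩
  have h1 := congrFun h ![diagGen, symGen]
  rw [differential_one] at h1
  change _ = areaCochain w ![diagGen, symGen] at h1
  -- The bracket lies in 𝔨, so only the terms of the form `X · η(Y)` survive in `dη`, and `ε`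
  -- annihilates those.
  have h2 : η ![⁅diagGen, symGen⁆] = 0 := by
    refine hη.1 _ ⟨0, ?_⟩
    rw [mem_lieK_iff]
    simp [bracket_diagGen_symGen, coord_gens]
  have h3 := congrArg ε h1
  simp [hε, h2, areaCochain_apply, coord_gens] at h3
  exact hεw h3.symm

/-- The 1-cochain with value `w` on the raising operator. -/
noncomputable def raiseCochain (w : V) : LieG [⋀^Fin 1]→ₗ[ℝ] V :=
  AlternatingMap.ofSubsingleton ℝ LieG V 0
    (coordA.smulRight w - coordB.smulRight (Complex.I • w))

theorem raiseCochain_apply (w : V) (x : Fin 1 → LieG) :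
    raiseCochain w x = ((coordA (x 0) : ℂ) - Complex.I * coordB (x 0)) • w := by
  change coordA (x 0) • w - coordB (x 0) • Complex.I • w = _
  rw [← Complex.coe_smul, ← Complex.coe_smul]
  match_scalars
  ring

/-- The form `coordA - i coordB` is multiplied by `exp(2iθ)` under `Ad (rot θ)`, so equivariance is
exactly weight 2. It vanishes on the lowering direction, so closedness needs only `lower w = 0` and
the action of 𝔨. -/
theorem raiseCochain_mem_cocycle {w : V} (hw : ρ.HasWeight 2 w) (hl : ρ.lower w = 0) :
    raiseCochain w ∈ ρ.cocycle 1 := by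
  refine ⟨⟨fun x hx => ?_, fun κ x => ?_⟩, ?_⟩
  · rw [raiseCochain_apply]
    obtain ⟨i, hi⟩ := hx
    rw [mem_lieK_iff, Subsingleton.elim i 0] at hi
    simp [hi]
  · obtain ⟨θ, rfl⟩ := exists_rot κ
    rw [raiseCochain_apply, raiseCochain_apply, map_smul, hw θ, smul_smul]
    obtain ⟨h1, h2, -⟩ := coord_Ad_rot θ (x 0)
    have e : Complex.exp (((2 : ℤ) : ℂ) * θ * Complex.I) =
        Real.cos (2 * θ) + Real.sin (2 * θ) * Complex.I := by
      rw [Complex.ofReal_cos, Complex.ofReal_sin, ← Complex.exp_mul_I]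
      congr 1
      push_cast
      ring
    rw [h1, h2, e]
    generalize Real.cos (2 * θ) = c
    generalize Real.sin (2 * θ) = s
    congr 1
    push_cast
    linear_combination (s * coordB (x 0) : ℂ) * Complex.I_sq
  · rw [SetLike.mem_coe, LinearMap.mem_ker]
    funext x
    have h0 : ρ.lie rotGen w = (2 * Complex.I) • w := by simpa using hw.rotGen
    have h1 : ρ.lie diagGen w = Complex.I • ρ.lie symGen w := by
      rwa [lower_apply, sub_eq_zero] at hl
    obtain ⟨p, hX⟩ : ∃ p : V, ∀ X, ρ.lie X w = (2 * Complex.I * coordE X) • w +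
        (Complex.I * coordA X + coordB X) • p := ⟨ρ.lie symGen w, fun X => by
      rw [lie_eq_coord, h0, h1]
      match_scalars <;> ring⟩
    simp only [differential_one, raiseCochain_apply, map_smul, hX, Pi.zero_apply,
      Matrix.cons_val_zero, coordA_bracket, coordB_bracket]
    match_scalars
    · linear_combination (2 * (coordB (x 0) * coordE (x 1) - coordB (x 1) * coordE (x 0)) : ℂ) *
        Complex.I_sq
    · linear_combination (coordA (x 1) * coordB (x 0) - coordB (x 1) * coordA (x 0) : ℂ) *
        Complex.I_sq

/-- A lowest weight vector of weight `2` gives a nonzero class in `H¹(𝔤, K; V)` if `V` has no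
nonzero `𝔨`-invariants. -/
theorem nontrivial_cohomology_one {w : V} (hw : ρ.HasWeight 2 w) (hl : ρ.lower w = 0) (hne : w ≠ 0)
    (h0 : ∀ v, ρ.lie rotGen v = 0 → v = 0) : Nontrivial (ρ.cohomology 1) := by
  refine nontrivial_cohomology (raiseCochain_mem_cocycle hw hl) ?_
  rintro ⟨-, η, hη, h⟩
  -- A 0-cochain is a K-invariant vector, and there is none but zero.
  have hη0 : η = 0 := by
    ext x
    refine h0 _ ?_
    have hwt : ρ.HasWeight 0 (η x) := fun θ => by
      rw [← hη.2, Subsingleton.elim (fun i => Ad (rot θ) (x i)) x]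
      simp
    simpa using hwt.rotGen
  rw [hη0, map_zero] at h
  have h1 : (0 : V) = raiseCochain w ![diagGen] := congrFun h ![diagGen]
  rw [raiseCochain_apply] at h1
  simp [coord_gens] at h1
  exact hne h1.symm

end GKModule

namespace GKModule

variable {V : Type*} [AddCommGroup V] [Module ℂ V] {ρ : GKModule V}

/-! ### Lowest weight modules -/

/-- The `(𝔤, K)`-module is generated by the lowest weight vector `v` of weight `k`. -/
structure IsLowestWeight (ρ : GKModule V) (k : ℤ) (v : V) : Prop where
  weight : ρ.HasWeight k v
  lower : ρ.lower v = 0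
  span : Submodule.span ℂ (Set.range fun j : ℕ => (ρ.raise ^ j) v) = ⊤

/-- `T` must be closed under going up, and under going down except across a step whose lowering
coefficient vanishes. It is applied to all of `ℕ` and to the tail beyond `-k`. -/
theorem isSubmodule_span_raise {k : ℤ} {v : V} (hv : ρ.HasWeight k v) (hl : ρ.lower v = 0)
    (T : Set ℕ) (hT : ∀ j ∈ T, j + 1 ∈ T) (hT' : ∀ j, j + 1 ∈ T → j ∈ T ∨ (k : ℂ) + j = 0) :
    ρ.IsSubmodule (Submodule.span ℂ ((fun j : ℕ => (ρ.raise ^ j) v) '' T)) := by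
  set N := Submodule.span ℂ ((fun j : ℕ => (ρ.raise ^ j) v) '' T) with hN
  have hmem : ∀ j ∈ T, (ρ.raise ^ j) v ∈ N := fun j hj => Submodule.subset_span ⟨j, hj, rfl⟩
  have hstable : ∀ f : Module.End ℂ V, (∀ j ∈ T, f ((ρ.raise ^ j) v) ∈ N) → ∀ x ∈ N, f x ∈ N := by
    intro f hf
    change N ≤ N.comap f
    rw [hN, Submodule.span_le]
    rintro _ ⟨j, hj, rfl⟩
    exact hf j hj
  constructor
  · intro X x hx
    rw [lie_eq_raise_lower]
    refine N.add_mem (N.add_mem (N.smul_mem _ ?_) (N.smul_mem _ ?_)) (N.smul_mem _ ?_)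
    · refine hstable _ (fun j hj => ?_) x hx
      rw [(hv.pow_raise j).rotGen]
      exact N.smul_mem _ (hmem j hj)
    · refine hstable _ (fun j hj => ?_) x hx
      rw [← Module.End.mul_apply, ← pow_succ']
      exact hmem _ (hT j hj)
    · refine hstable _ (fun j hj => ?_) x hx
      rcases j with _ | j
      · rw [pow_zero, Module.End.one_apply, hl]
        exact N.zero_mem
      · rw [hv.lower_pow_raise hl]
        rcases hT' j hj with h | h
        · exact N.smul_mem _ (hmem j h)
        · rw [h, mul_zero, zero_smul]
          exact N.zero_mem
  · intro κ x hx
    obtain ⟨θ, rfl⟩ := exists_rot κ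
    refine hstable _ (fun j hj => ?_) x hx
    rw [hv.pow_raise j θ]
    exact N.smul_mem _ (hmem j hj)

theorem mem_generated (ρ : GKModule V) (v : V) : v ∈ ρ.generated v := by
  rw [generated, Submodule.mem_sInf]
  exact fun N hN => hN.2

theorem coe_pow_raise_restrict {N : Submodule ℂ V} (hN : ρ.IsSubmodule N) (x : N) (j : ℕ) :
    (((ρ.restrict N hN).raise ^ j) x : V) = (ρ.raise ^ j) x := by
  induction j with
  | zero => rfl
  | succ j ih =>
    rw [pow_succ', pow_succ', Module.End.mul_apply, Module.End.mul_apply, ← ih]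
    rfl

/-- The span of all `R^j v` is already a submodule containing `v`, so it contains the generated one.
The spanning statement is then pulled back along the inclusion. -/
theorem isLowestWeight_generated {k : ℤ} {v : V} (hv : ρ.HasWeight k v) (hl : ρ.lower v = 0) :
    (ρ.restrict (ρ.generated v) (ρ.isSubmodule_generated v)).IsLowestWeight k
      ⟨v, ρ.mem_generated v⟩ where
  weight θ := Subtype.ext (hv θ)
  lower := Subtype.ext hl
  span := by
    have hle : ρ.generated v ≤
        Submodule.span ℂ ((fun j : ℕ => (ρ.raise ^ j) v) '' Set.univ) :=
      sInf_le ⟨isSubmodule_span_raise hv hl Set.univ (fun _ _ => trivial)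
        (fun _ _ => Or.inl trivial), Submodule.subset_span ⟨0, trivial, rfl⟩⟩
    rw [eq_top_iff]
    intro x _
    have hx := hle x.2
    have e : (fun j : ℕ => (ρ.raise ^ j) v) '' Set.univ = (ρ.generated v).subtype ''
        (Set.range fun j : ℕ =>
          ((ρ.restrict (ρ.generated v) (ρ.isSubmodule_generated v)).raise ^ j)
            ⟨v, ρ.mem_generated v⟩) := by
      rw [Set.image_univ, ← Set.range_comp]
      congr 1
      funext j
      exact (coe_pow_raise_restrict (ρ.isSubmodule_generated v)
        ⟨v, ρ.mem_generated v⟩ j).symm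
    rw [e, ← Submodule.map_span (ρ.generated v).subtype] at hx
    obtain ⟨y, hy, hyx⟩ := Submodule.mem_map.1 hx
    rw [SetLike.coe_eq_coe.1 hyx] at hy
    exact hy

theorem eq_zero_of_rotGen_eq_zero {S : Set V} (hS : ∀ s ∈ S, ∃ n : ℤ, n ≠ 0 ∧ ρ.HasWeight n s)
    (htop : Submodule.span ℂ S = ⊤) {v : V} (hv : ρ.lie rotGen v = 0) : v = 0 := by
  refine eq_zero_of_mem_span_eigenvectors (f := ρ.lie rotGen) (S := S) (μ := 0) ?_
    (htop ▸ Submodule.mem_top) (by rw [hv, zero_smul])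
  intro s hs
  obtain ⟨n, hn, h⟩ := hS s hs
  exact ⟨n * Complex.I, mul_ne_zero (Int.cast_ne_zero.2 hn) Complex.I_ne_zero, h.rotGen⟩

/-- For `j > 0` the vectors `R^j v` have weights `k + 2j ≠ k`, and eigenvectors of `rotGen` with
distinct eigenvalues are independent. -/
theorem notMem_span_pow_raise {k : ℤ} {v : V} (hv : ρ.HasWeight k v) (hne : v ≠ 0) {T : Set ℕ}
    (hT : 0 ∉ T) : v ∉ Submodule.span ℂ ((fun j : ℕ => (ρ.raise ^ j) v) '' T) := by
  intro hmem
  refine hne (eq_zero_of_mem_span_eigenvectors (f := ρ.lie rotGen) (μ := k * Complex.I) ?_ hmem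
    hv.rotGen)
  rintro _ ⟨j, hj, rfl⟩
  refine ⟨_, ?_, (hv.pow_raise j).rotGen⟩
  intro h
  have h1 := mul_right_cancel₀ Complex.I_ne_zero h
  have h2 : k + 2 * (j : ℤ) = k := by exact_mod_cast h1
  have : j = 0 := by omega
  exact hT (this ▸ hj)

/-- The coordinate functional of a lowest weight vector. -/
theorem HasWeight.exists_coord {k : ℤ} {v : V} (hv : ρ.HasWeight k v) (hne : v ≠ 0) :
    ∃ ε : Module.Dual ℂ V, ε v = 1 ∧ ∀ j : ℕ, ε ((ρ.raise ^ (j + 1)) v) = 0 := by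
  obtain ⟨f, hf, hker⟩ := Submodule.exists_le_ker_of_notMem
    (notMem_span_pow_raise hv hne (T := {j | j ≠ 0}) (by simp))
  refine ⟨(f v)⁻¹ • f, ?_, fun j => ?_⟩
  · simp [hf]
  · have : f ((ρ.raise ^ (j + 1)) v) = 0 :=
      hker (Submodule.subset_span ⟨j + 1, Nat.succ_ne_zero j, rfl⟩)
    simp [this]

/-! ### Quotients and duals -/

/-- The quotient of a `(𝔤, K)`-module by a submodule. -/
def quotient (ρ : GKModule V) (N : Submodule ℂ V) (hN : ρ.IsSubmodule N) : GKModule (V ⧸ N) where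
  lie :=
    { toFun := fun X => N.mapQ N (ρ.lie X) (hN.lie_mem X)
      map_add' := by intro X Y; ext v; simp
      map_smul' := by intro c X; ext v; simp [← Complex.coe_smul] }
  grp :=
    { toFun := fun κ => N.mapQ N (ρ.grp κ) (hN.grp_mem κ)
      map_one' := by ext v; simp
      map_mul' := by intro a b; ext v; simp }
  lie_bracket X Y v := by
    obtain ⟨v, rfl⟩ := N.mkQ_surjective v
    simp [ρ.lie_bracket]
  grp_lie κ X v := by
    obtain ⟨v, rfl⟩ := N.mkQ_surjective v
    simp [ρ.grp_lie]
  grp_finite v := by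
    obtain ⟨v, rfl⟩ := N.mkQ_surjective v
    obtain ⟨W, hW, h⟩ := ρ.grp_finite v
    exact ⟨W.map N.mkQ, inferInstance, fun κ => ⟨_, h κ, rfl⟩⟩
  grp_deriv v ℓ := by
    obtain ⟨v, rfl⟩ := N.mkQ_surjective v
    exact ρ.grp_deriv v (ℓ ∘ₗ N.mkQ)

theorem pow_raise_quotient {N : Submodule ℂ V} (hN : ρ.IsSubmodule N) (v : V) (j : ℕ) :
    ((ρ.quotient N hN).raise ^ j) (N.mkQ v) = N.mkQ ((ρ.raise ^ j) v) := by
  induction j with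
  | zero => rfl
  | succ j ih =>
    rw [pow_succ', pow_succ', Module.End.mul_apply, Module.End.mul_apply, ih]
    rfl

theorem IsLowestWeight.quotient {k : ℤ} {v : V} (h : ρ.IsLowestWeight k v) {N : Submodule ℂ V}
    (hN : ρ.IsSubmodule N) : (ρ.quotient N hN).IsLowestWeight k (N.mkQ v) where
  weight θ := congrArg N.mkQ (h.weight θ)
  lower := (congrArg N.mkQ h.lower).trans (map_zero _)
  span := by
    have e : (Set.range fun j : ℕ => ((ρ.quotient N hN).raise ^ j) (N.mkQ v)) =
        N.mkQ '' (Set.range fun j : ℕ => (ρ.raise ^ j) v) := by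
      rw [← Set.range_comp]
      congr 1
      funext j
      exact pow_raise_quotient hN v j
    rw [e, ← Submodule.map_span, h.span, Submodule.map_top, Submodule.range_mkQ]

theorem rot_inv (θ : ℝ) : (rot θ)⁻¹ = rot (-θ) := by
  ext i j
  rw [Subgroup.coe_inv, rot_inv_entries]
  fin_cases i <;> fin_cases j <;> simp [rot]

/-- The contragredient of a finite-dimensional `(𝔤, K)`-module. -/
def dual (ρ : GKModule V) [FiniteDimensional ℂ V] : GKModule (Module.Dual ℂ V) where
  lie :=
    { toFun := fun X => -(ρ.lie X).dualMap
      map_add' := by intro X Y; ext f v; simp [add_comm]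
      map_smul' := by intro c X; ext f v; simp [← Complex.coe_smul] }
  grp :=
    { toFun := fun κ => (ρ.grp κ⁻¹).dualMap
      map_one' := by ext f v; simp
      map_mul' := by intro a b; ext f v; simp }
  lie_bracket X Y f := by
    ext v
    simp [ρ.lie_bracket]
  grp_lie κ X f := by
    ext v
    have h := ρ.grp_lie κ X (ρ.grp κ⁻¹ v)
    rw [← Module.End.mul_apply (ρ.grp κ) (ρ.grp κ⁻¹), ← map_mul, mul_inv_cancel, map_one,
      Module.End.one_apply] at h
    have h2 : ρ.grp κ⁻¹ (ρ.lie (Ad κ X) v) = ρ.lie X (ρ.grp κ⁻¹ v) := by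
      rw [← h, ← Module.End.mul_apply, ← map_mul, inv_mul_cancel, map_one, Module.End.one_apply]
    simp [h2]
  grp_finite f := ⟨⊤, inferInstance, fun _ => Submodule.mem_top⟩
  grp_deriv f Φ := by
    obtain ⟨v, rfl⟩ := (Module.evalEquiv ℂ V).surjective Φ
    -- Written at `-0` so that the chain rule with `θ ↦ -θ` applies; this gives the sign of the dual
    -- action.
    have h1 : HasDerivAt (fun θ : ℝ => f (ρ.grp (rot θ) v)) (f (ρ.lie rotGen v)) (-0) := by
      rw [neg_zero]
      exact ρ.grp_deriv v f
    have h2 := h1.scomp (0 : ℝ) (hasDerivAt_neg 0)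
    simpa [rot_inv, Function.comp_def] using! h2

theorem finiteDimensional_quotient_span_pow_raise {k : ℤ} {v : V} (h : ρ.IsLowestWeight k v)
    (n : ℕ) : FiniteDimensional ℂ
      (V ⧸ Submodule.span ℂ ((fun j : ℕ => (ρ.raise ^ j) v) '' Set.Ici n)) := by
  set N := Submodule.span ℂ ((fun j : ℕ => (ρ.raise ^ j) v) '' Set.Ici n)
  have hfin : (N.mkQ '' ((fun j : ℕ => (ρ.raise ^ j) v) '' Set.Iio n)).Finite :=
    ((Set.finite_Iio n).image _).image _
  refine ⟨(Submodule.fg_def).2 ⟨_, hfin, ?_⟩⟩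
  rw [eq_top_iff, ← Submodule.range_mkQ N, ← Submodule.map_top, ← h.span, Submodule.map_span,
    Submodule.span_le]
  rintro _ ⟨_, ⟨j, rfl⟩, rfl⟩
  rcases lt_or_ge j n with hj | hj
  · exact Submodule.subset_span ⟨_, ⟨j, hj, rfl⟩, rfl⟩
  · have h0 : N.mkQ ((ρ.raise ^ j) v) = 0 :=
      (Submodule.Quotient.mk_eq_zero N).2 (Submodule.subset_span ⟨j, hj, rfl⟩)
    change N.mkQ ((ρ.raise ^ j) v) ∈ _
    rw [h0]
    exact Submodule.zero_mem _

/-- A lowest weight module of lowest weight `k ≤ 0` has a finite-dimensional lowest weight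
quotient. -/
theorem IsLowestWeight.exists_finiteDimensional_quotient {k : ℤ} {v : V}
    (h : ρ.IsLowestWeight k v) (hne : v ≠ 0) (hk : k ≤ 0) :
    ∃ (N : Submodule ℂ V) (hN : ρ.IsSubmodule N), FiniteDimensional ℂ (V ⧸ N) ∧
      (ρ.quotient N hN).IsLowestWeight k (N.mkQ v) ∧ N.mkQ v ≠ 0 := by
  -- The tail starts at `1 - k ≥ 1`, so it omits `v`; the step down from its first vector has `j =
  -- -k`, where the lowering coefficient is zero.
  have hN := isSubmodule_span_raise h.weight h.lower (Set.Ici (1 - k).toNat)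
    (fun j hj => le_trans hj (Nat.le_succ j)) (fun j hj => by
      rw [Set.mem_Ici] at hj ⊢
      rcases hj.lt_or_eq with hj | hj
      · exact Or.inl (Nat.lt_succ_iff.1 hj)
      · right
        have : k + j = 0 := by omega
        exact_mod_cast this)
  refine ⟨_, hN, finiteDimensional_quotient_span_pow_raise h _, h.quotient hN, ?_⟩
  intro h0
  refine notMem_span_pow_raise h.weight hne ?_ ((Submodule.Quotient.mk_eq_zero _).1 h0)
  rw [Set.mem_Ici]
  omega

/-! ### Tensor products -/

variable {M : Type*} [AddCommGroup M] [Module ℂ M] {σ : GKModule M}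

theorem tensor_lie_tmul (X : LieG) (v : V) (m : M) :
    (ρ.tensor σ).lie X (v ⊗ₜ m) = ρ.lie X v ⊗ₜ m + v ⊗ₜ σ.lie X m := rfl

theorem tensor_grp_tmul (κ : SO2) (v : V) (m : M) :
    (ρ.tensor σ).grp κ (v ⊗ₜ m) = ρ.grp κ v ⊗ₜ σ.grp κ m := rfl

theorem HasWeight.tmul {a b : ℤ} {v : V} {m : M} (hv : ρ.HasWeight a v) (hm : σ.HasWeight b m) :
    (ρ.tensor σ).HasWeight (a + b) (v ⊗ₜ m) := by
  intro θ
  rw [tensor_grp_tmul, hv θ, hm θ, TensorProduct.smul_tmul_smul, ← Complex.exp_add]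
  congr 2
  push_cast
  ring

theorem tensor_lower_tmul (v : V) (m : M) :
    (ρ.tensor σ).lower (v ⊗ₜ m) = ρ.lower v ⊗ₜ m + v ⊗ₜ σ.lower m := by
  simp only [lower_apply, tensor_lie_tmul, TensorProduct.sub_tmul, TensorProduct.tmul_sub,
    smul_add, TensorProduct.smul_tmul', TensorProduct.tmul_smul]
  abel

theorem span_tmul_eq_top {S : Set V} {T : Set M} (hS : Submodule.span ℂ S = ⊤)
    (hT : Submodule.span ℂ T = ⊤) :
    Submodule.span ℂ (Set.image2 (fun (v : V) (m : M) => v ⊗ₜ[ℂ] m) S T) = ⊤ := by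
  have h := Submodule.map₂_span_span ℂ (TensorProduct.mk ℂ V M) S T
  rw [hS, hT, TensorProduct.map₂_mk_top_top_eq_top] at h
  exact h.symm

theorem tmul_ne_zero {v : V} {m : M} (hv : v ≠ 0) (hm : m ≠ 0) : v ⊗ₜ[ℂ] m ≠ 0 := by
  obtain ⟨f, hf⟩ := Module.Projective.exists_dual_ne_zero ℂ hv
  obtain ⟨g, hg⟩ := Module.Projective.exists_dual_ne_zero ℂ hm
  intro h
  have h' := congrArg (LinearMap.mul' ℂ ℂ ∘ₗ TensorProduct.map f g) h
  simp [hf, hg] at h'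

end GKModule

namespace GKModule

variable {V : Type*} [AddCommGroup V] [Module ℂ V] {ρ : GKModule V} {k : ℤ} {v : V}

/-! ### Cohomology of lowest weight modules -/

/-- In lowest weight 0 the coefficient of `v` is a 𝔤-invariant functional: `v` has weight 0, and the
only way back to it, lowering `R v`, has coefficient zero. -/
theorem IsLowestWeight.nontrivial_cohomology_two (h : ρ.IsLowestWeight 0 v) (hne : v ≠ 0) :
    Nontrivial (ρ.cohomology 2) := by
  obtain ⟨ε, hε, hε'⟩ := h.weight.exists_coord hne
  refine GKModule.nontrivial_cohomology_two h.weight ε (fun X x => ?_) (hε ▸ one_ne_zero)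
  have hx : x ∈ Submodule.span ℂ (Set.range fun j : ℕ => (ρ.raise ^ j) v) :=
    h.span ▸ Submodule.mem_top
  induction hx using Submodule.span_induction with
  | zero => simp
  | add x y _ _ hx hy => rw [map_add, map_add, hx, hy, add_zero]
  | smul c x _ hx => rw [map_smul, map_smul, hx, smul_zero]
  | mem x hx =>
    obtain ⟨j, rfl⟩ := hx
    have hr : ε (ρ.raise ((ρ.raise ^ j) v)) = 0 := by
      rw [← Module.End.mul_apply, ← pow_succ', hε']
    have hl : ε (ρ.lower ((ρ.raise ^ j) v)) = 0 := by
      -- For `j = 0` the vector is killed, for `j = 1` the coefficient is a multiple of the weight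
      -- 0, and for `j ≥ 2` the result stays above `v`.
      rcases j with _ | _ | j
      · rw [pow_zero, Module.End.one_apply, h.lower, map_zero]
      · rw [h.weight.lower_pow_raise h.lower]
        simp
      · rw [h.weight.lower_pow_raise h.lower, map_smul, hε', smul_zero]
    have he : ε (ρ.lie rotGen ((ρ.raise ^ j) v)) = 0 := by
      rw [(h.weight.pow_raise j).rotGen, map_smul]
      rcases j with _ | j
      · simp
      · rw [hε', smul_zero]
    rw [lie_eq_raise_lower, map_add, map_add, map_smul, map_smul, map_smul, hr, hl, he]
    simp

theorem IsLowestWeight.nontrivial_cohomology_one (h : ρ.IsLowestWeight 2 v) (hne : v ≠ 0) :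
    Nontrivial (ρ.cohomology 1) := by
  refine GKModule.nontrivial_cohomology_one h.weight h.lower hne fun x hx =>
    eq_zero_of_rotGen_eq_zero ?_ h.span hx
  rintro _ ⟨j, rfl⟩
  exact ⟨_, by omega, h.weight.pow_raise j⟩

theorem IsLowestWeight.isCohomological_of_nonpos {V : Type} [AddCommGroup V] [Module ℂ V]
    {ρ : GKModule V} {v : V} (h : ρ.IsLowestWeight k v) (hne : v ≠ 0) (hk : k ≤ 0) :
    ρ.IsCohomological := by
  obtain ⟨N, hN, hfin, hQ, hQne⟩ := h.exists_finiteDimensional_quotient hne hk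
  refine ⟨Module.Dual ℂ (V ⧸ N), inferInstance, inferInstance, (ρ.quotient N hN).dual, 2,
    inferInstance, ?_⟩
  obtain ⟨f, hf, hf'⟩ := hQ.weight.exists_coord hQne
  have hfw : (ρ.quotient N hN).dual.HasWeight (-k) f := by
    intro θ
    -- Both sides vanish on the higher `R^j` vectors, so only the lowest weight vector has to be
    -- compared.
    refine LinearMap.ext_on hQ.span ?_
    rintro _ ⟨j, rfl⟩
    change f ((ρ.quotient N hN).grp (rot θ)⁻¹ _) = (_ : ℂ) • f _
    rw [rot_inv, hQ.weight.pow_raise j (-θ), map_smul]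
    rcases j with _ | j
    · simp
    · rw [hf', smul_zero, smul_zero]
  -- The evaluation pairing `x ⊗ g ↦ g([x])`. It is invariant because the dual action carries a
  -- minus sign.
  let ε : Module.Dual ℂ (V ⊗[ℂ] Module.Dual ℂ (V ⧸ N)) :=
    TensorProduct.lift (Module.Dual.eval ℂ (V ⧸ N) ∘ₗ N.mkQ)
  refine GKModule.nontrivial_cohomology_two (w := v ⊗ₜ f) ?_ ε (fun X x => ?_) ?_
  · simpa using h.weight.tmul hfw
  · induction x with
    | zero => simp
    | add x y hx hy => rw [map_add, map_add, hx, hy, add_zero]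
    | tmul x g =>
      rw [tensor_lie_tmul, map_add]
      change g (N.mkQ (ρ.lie X x)) + -g (N.mkQ (ρ.lie X x)) = 0
      exact add_neg_cancel _
  · change f (N.mkQ v) ≠ 0
    rw [hf]
    exact one_ne_zero

/-- The lowest weight `2 - k` is chosen so that `v ⊗ m` has weight 2. All weights `2 + 2i + 2j` are
then positive, which excludes 𝔨-invariants. -/
theorem IsLowestWeight.isCohomological_of_finiteDimensional {M : Type} [AddCommGroup M]
    [Module ℂ M] [FiniteDimensional ℂ M] {σ : GKModule M} {m : M} (h : ρ.IsLowestWeight k v)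
    (hv : v ≠ 0) (hσ : σ.IsLowestWeight (2 - k) m) (hm : m ≠ 0) : ρ.IsCohomological := by
  refine ⟨M, inferInstance, inferInstance, σ, 1, inferInstance, ?_⟩
  refine GKModule.nontrivial_cohomology_one (w := v ⊗ₜ m) ?_ ?_ (tmul_ne_zero hv hm) fun x hx =>
    eq_zero_of_rotGen_eq_zero ?_ (span_tmul_eq_top h.span hσ.span) hx
  · simpa using h.weight.tmul hσ.weight
  · rw [tensor_lower_tmul, h.lower, hσ.lower, TensorProduct.zero_tmul, TensorProduct.tmul_zero,
      add_zero]
  · rintro _ ⟨_, ⟨i, rfl⟩, _, ⟨j, rfl⟩, rfl⟩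
    exact ⟨_, by omega, (h.weight.pow_raise i).tmul (hσ.weight.pow_raise j)⟩

end GKModule

/-! ### Lifts of holomorphic functions -/

open UpperHalfPlane (ofComplex)

/-- The lift is a holomorphic function of the column `g · (i, 1)ᵗ`. Hence its derivative along `X`
is a complex linear form in `X · (i, 1)ᵗ`, which is the Cauchy–Riemann equation on the group. -/
theorem exists_lieDeriv_liftG {f : ℍ → ℂ}
    (hf : DifferentiableOn ℂ (f ∘ ofComplex) {z : ℂ | 0 < z.im}) (k : ℤ) (g : SL(2, ℝ)) :
    ∃ α β : ℂ, ∀ X : LieG, lieDeriv X (liftG k f) g =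
      α * (X.1 0 0 * Complex.I + X.1 0 1) + β * (X.1 1 0 * Complex.I + X.1 1 1) := by
  have hopen : IsOpen {z : ℂ | 0 < z.im} := isOpen_lt continuous_const Complex.continuous_im
  let row : Fin 2 → SL(2, ℝ) → ℂ := fun r h => (h.1 r 0 : ℂ) * Complex.I + (h.1 r 1 : ℂ)
  have hsmul : ∀ h : SL(2, ℝ), ((h • UpperHalfPlane.I : ℍ) : ℂ) = row 0 h / row 1 h := by
    intro h
    rw [UpperHalfPlane.specialLinearGroup_apply]
    rfl
  have hlift : ∀ h, liftG k f h = row 1 h ^ (-k) * (f ∘ ofComplex) (row 0 h / row 1 h) := by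
    intro h
    rw [← hsmul, Function.comp_apply, UpperHalfPlane.ofComplex_apply]
    rfl
  have hne : row 1 g ≠ 0 := by
    intro h0
    have e1 : g.1 1 1 = 0 := by simpa [row] using congrArg Complex.re h0
    have e2 : g.1 1 0 = 0 := by simpa [row] using congrArg Complex.im h0
    have hd := g.2
    rw [Matrix.det_fin_two, e1, e2] at hd
    simp at hd
  have him : 0 < (row 0 g / row 1 g).im := hsmul g ▸ (g • UpperHalfPlane.I : ℍ).im_pos
  have hdf := (hf.differentiableAt (hopen.mem_nhds him)).hasDerivAt
  set D := deriv (f ∘ ofComplex) (row 0 g / row 1 g)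
  have hrow : ∀ (X : LieG) (r : Fin 2), HasDerivAt (fun t : ℝ => row r (g * expG (t • X)))
      (g.1 r 0 * (X.1 0 0 * Complex.I + X.1 0 1) + g.1 r 1 * (X.1 1 0 * Complex.I + X.1 1 1)) 0 := by
    intro X r
    have he : ∀ i j, HasDerivAt (fun t : ℝ => ((expG (t • X)).1 i j : ℂ)) (X.1 i j : ℂ) 0 :=
      fun i j => (hasDerivAt_expG X i j).ofReal_comp
    have h := (((he 0 0).mul_const Complex.I).add (he 0 1)).const_mul (g.1 r 0 : ℂ) |>.add
      ((((he 1 0).mul_const Complex.I).add (he 1 1)).const_mul (g.1 r 1 : ℂ))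
    refine h.congr_of_eventuallyEq (Filter.Eventually.of_forall fun t => ?_)
    simp only [row, Matrix.SpecialLinearGroup.coe_mul, Matrix.mul_apply, Fin.sum_univ_two,
      Pi.add_apply]
    push_cast
    ring
  have key : ∀ X : LieG, ∀ a b : ℂ,
      HasDerivAt (fun t : ℝ => row 0 (g * expG (t • X))) a 0 →
      HasDerivAt (fun t : ℝ => row 1 (g * expG (t • X))) b 0 →
      lieDeriv X (liftG k f) g = (((-k : ℤ) : ℂ) * row 1 g ^ (-k - 1) * b) *
        (f ∘ ofComplex) (row 0 g / row 1 g) + row 1 g ^ (-k) *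
          (D * ((a * row 1 g - row 0 g * b) / row 1 g ^ 2)) := by
    intro X a b ha hb
    have e1 : g * expG ((0 : ℝ) • X) = g := by rw [expG_zero_smul, mul_one]
    have hz : HasDerivAt (fun z : ℂ => z ^ (-k)) (((-k : ℤ) : ℂ) * row 1 g ^ (-k - 1))
        (row 1 (g * expG ((0 : ℝ) • X))) := by
      rw [e1]
      exact hasDerivAt_zpow (-k) _ (Or.inl hne)
    have hq := ha.div hb (by rw [e1]; exact hne)
    have hD : HasDerivAt (f ∘ ofComplex) D (((fun t : ℝ => row 0 (g * expG (t • X))) /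
        fun t : ℝ => row 1 (g * expG (t • X))) 0) := by
      rw [Pi.div_apply, e1]
      exact hdf
    have h := (hz.comp (0 : ℝ) hb).mul (hD.comp (0 : ℝ) hq)
    simp only [Function.comp_apply, Pi.div_apply, e1] at h
    refine HasDerivAt.deriv (h.congr_of_eventuallyEq (Filter.Eventually.of_forall fun t => ?_))
    exact hlift _
  obtain ⟨p, r, hpr⟩ : ∃ p r : ℂ, ∀ a b : ℂ, (((-k : ℤ) : ℂ) * row 1 g ^ (-k - 1) * b) *
      (f ∘ ofComplex) (row 0 g / row 1 g) + row 1 g ^ (-k) *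
        (D * ((a * row 1 g - row 0 g * b) / row 1 g ^ 2)) = p * a + r * b :=
    ⟨row 1 g ^ (-k) * D * row 1 g / row 1 g ^ 2, ((-k : ℤ) : ℂ) * row 1 g ^ (-k - 1) *
      (f ∘ ofComplex) (row 0 g / row 1 g) - row 1 g ^ (-k) * D * row 0 g / row 1 g ^ 2,
      fun a b => by ring⟩
  -- The derivative is `p`, `r` paired with `g · X · (i, 1)ᵗ`, so the coefficients are the row `(p,
  -- r)` times `g`.
  refine ⟨p * g.1 0 0 + r * g.1 1 0, p * g.1 0 1 + r * g.1 1 1, fun X => ?_⟩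
  rw [key X _ _ (hrow X 0) (hrow X 1), hpr]
  ring

/-- The matrix `diagGen - i symGen` annihilates the column `(i, 1)ᵗ`. -/
theorem lower_liftG {f : ℍ → ℂ} (hf : DifferentiableOn ℂ (f ∘ ofComplex) {z : ℂ | 0 < z.im})
    (k : ℤ) : functionModule.lower ⟨liftG k f, liftG_mem hf k⟩ = 0 := by
  ext g
  change lieDeriv diagGen (liftG k f) g - Complex.I * lieDeriv symGen (liftG k f) g = 0
  obtain ⟨α, β, h⟩ := exists_lieDeriv_liftG hf k g
  rw [h, h]
  simp only [diagGen, symGen, Matrix.of_apply, Matrix.cons_val', Matrix.cons_val_zero,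
    Matrix.cons_val_one, Matrix.cons_val_fin_one]
  push_cast
  linear_combination -β * Complex.I_sq

/-- Rotations fix `i` and multiply `ci + d` by `exp(-iθ)`. -/
theorem hasWeight_liftG {f : ℍ → ℂ} (hf : DifferentiableOn ℂ (f ∘ ofComplex) {z : ℂ | 0 < z.im})
    (k : ℤ) : functionModule.HasWeight k ⟨liftG k f, liftG_mem hf k⟩ := by
  intro θ
  ext g
  change (((g * (rot θ : SO2)).1 1 0 : ℝ) * Complex.I + ((g * (rot θ : SO2)).1 1 1 : ℝ) : ℂ) ^ (-k)
    * f ((g * (rot θ : SO2)) • UpperHalfPlane.I) = Complex.exp (k * θ * Complex.I) *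
      (((g.1 1 0 : ℂ) * Complex.I + (g.1 1 1 : ℂ)) ^ (-k) * f (g • UpperHalfPlane.I))
  have e : (((g * (rot θ : SO2)).1 1 0 : ℝ) * Complex.I + ((g * (rot θ : SO2)).1 1 1 : ℝ) : ℂ) =
      Complex.exp (-(θ * Complex.I)) * ((g.1 1 0 : ℂ) * Complex.I + (g.1 1 1 : ℂ)) := by
    rw [← neg_mul, Complex.exp_mul_I, Complex.cos_neg, Complex.sin_neg]
    rw [Matrix.SpecialLinearGroup.coe_mul, Matrix.mul_apply, Matrix.mul_apply, Fin.sum_univ_two,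
      Fin.sum_univ_two]
    simp only [rot, Matrix.of_apply, Matrix.cons_val', Matrix.cons_val_zero, Matrix.cons_val_one,
      Matrix.cons_val_fin_one]
    push_cast
    linear_combination (g.1 1 0 * Complex.sin θ : ℂ) * Complex.I_sq
  have e2 : Complex.exp (-(θ * Complex.I)) ^ (-k) = Complex.exp (k * θ * Complex.I) := by
    rw [← Complex.exp_int_mul]
    congr 1
    push_cast
    ring
  rw [mul_smul, SO2_smul_I, e, mul_zpow, e2, mul_assoc]

theorem liftG_ne_zero {f : ℍ → ℂ} (hf : f ≠ 0) (k : ℤ) : liftG k f ≠ 0 := by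
  intro h
  apply hf
  funext τ
  -- G acts transitively on the upper half plane, so the lift determines the function.
  obtain ⟨g, rfl⟩ := MulAction.exists_smul_eq SL(2, ℝ) UpperHalfPlane.I τ
  refine (mul_eq_zero.1 (congrFun h g)).resolve_left (zpow_ne_zero _ ?_)
  intro h0
  have e1 : g.1 1 1 = 0 := by simpa using congrArg Complex.re h0
  have e2 : g.1 1 0 = 0 := by simpa using congrArg Complex.im h0
  have hd := g.2
  rw [Matrix.det_fin_two, e1, e2] at hd
  simp at hd

/-- For `k ≤ 0` there is a finite-dimensional `(𝔤, K)`-module of lowest weight `k`. -/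
theorem exists_finiteDimensional_isLowestWeight {k : ℤ} (hk : k ≤ 0) :
    ∃ (M : Type) (_ : AddCommGroup M) (_ : Module ℂ M) (σ : GKModule M) (m : M),
      FiniteDimensional ℂ M ∧ σ.IsLowestWeight k m ∧ m ≠ 0 := by
  have hf : DifferentiableOn ℂ ((1 : ℍ → ℂ) ∘ ofComplex) {z : ℂ | 0 < z.im} :=
    differentiableOn_const 1
  -- The lift of the constant 1, namely `(ci+d)^(-k)`, supplies a lowest weight vector of the
  -- required weight; its finite-dimensional quotient is the module sought.
  have h := GKModule.isLowestWeight_generated (hasWeight_liftG hf k) (lower_liftG hf k)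
  obtain ⟨N, hN, hfin, hQ, hne⟩ := h.exists_finiteDimensional_quotient (fun h0 =>
    liftG_ne_zero one_ne_zero k (congrArg (fun x => x.1.1) h0)) hk
  exact ⟨_, _, _, _, _, hfin, hQ, hne⟩

end MockModular

/-! ### The theorem for mock modular forms -/

theorem mainTheorem1 (k : ℤ) (Fp : ℍ → ℂ) (hF : IsMockModularForm k Fp) (hne : Fp ≠ 0) :
    (mockModule hF).IsCohomological ∧
      ((k = 0 ∨ k = 2) → ∃ q : ℕ, Nontrivial ((mockModule hF).cohomology q)) := by
  have h : (mockModule hF).IsLowestWeight k ⟨mockLift hF, functionModule.mem_generated _⟩ :=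
    GKModule.isLowestWeight_generated (hasWeight_liftG hF.differentiableOn k)
      (lower_liftG hF.differentiableOn k)
  have hv : (⟨mockLift hF, functionModule.mem_generated _⟩ :
      functionModule.generated (mockLift hF)) ≠ 0 := fun h0 =>
    liftG_ne_zero hne k (congrArg (fun x => x.1.1) h0)
  refine ⟨?_, ?_⟩
  · rcases le_or_gt k 0 with hk | hk
    · exact h.isCohomological_of_nonpos hv hk
    · have hk1 : k ≠ 1 := hF.1
      obtain ⟨M, _, _, σ, m, _, hσ, hm⟩ :=
        exists_finiteDimensional_isLowestWeight (k := 2 - k) (by omega)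
      exact h.isCohomological_of_finiteDimensional hv hσ hm
  · rintro (rfl | rfl)
    · exact ⟨2, h.nontrivial_cohomology_two hv⟩
    · exact ⟨1, h.nontrivial_cohomology_one hv⟩
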